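/- Let $m\in\mathbb{Z}$ with $m\neq 0$, and let $\alpha\ge 1$, $R>0$ and $P_0>0$ be real numbers. Consider the radial photorefractive equation $$(ru_r)_r-\frac{m^2}{r}u-\frac{ru}{1+\alpha u^2}=\beta r u,\qquad 0<r<R,\qquad u(0)=u(R)=0. \tag{1}$$ A positive classical solution of (1) is a function $u\in C^2[0,R]$ with $u(0)=u(R)=0$ and $u(r)>0$ for all $r\in(0,R)$ that satisfies the equation at every point $r\in(0,R)$. Let $\mathcal{U}$ be the set of absolutely continuous functions $u$ on $[0,R]$ with $u(0)=u(R)=0$ and $\int_0^R\left(ru_r^2+\frac{m^2}{r}u^2\right)dr<\infty$. For $u\in\mathcal U$ let $$I(u)=\frac12\int_0^R\left(ru_r^2+\frac{m^2}{r}u^2+\frac{r}{\alpha}\ln(1+\alpha u^2)\right)dr,\qquad P(u)=2\pi\int_0^R ru^2\,dr.$$ Then there exists a pair $(u,\beta)$ with $\beta\in\mathbb{R}$ such that $u\in\mathcal U$ solves the constrained minimization problem $$I(u)=\min\{I(w)\;:\;w\in\mathcal{U},\ P(w)=P_0\},\qquad P(u)=P_0, \tag{2}$$ $u$ is a positive classical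 solution of (1) with this $\beta$, and $\beta$ arises as a Lagrange multiplier: with $\lambda=-\beta/(4\pi)$, the directional derivatives of $I$ and $P$ at $u$ exist in every direction $v\in\mathcal{U}$ and satisfy $\langle I'(u),v\rangle=\lambda\langle P'(u),v\rangle$. Moreover, such solutions are obtained by solving (2): for every minimizer $u$ of (2) with $u\ge 0$ on $[0,R]$ there is a $\beta\in\mathbb{R}$ such that $u$ is a positive classical solution of (1) with this $\beta$, and $\lambda=-\beta/(4\pi)$ is a Lagrange multiplier in the above sense. -/

import Mathlib

open MeasureTheory Set

namespace PhotorefractiveSoliton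

noncomputable section

/-- The energy density `r u_r ^ 2 + (m ^ 2 / r) u ^ 2`. For an absolutely continuous `u` the
derivative exists at almost every `r`. -/
def energyDensity (m : ℤ) (u : ℝ → ℝ) (r : ℝ) : ℝ :=
  r * (deriv u r) ^ 2 + (m : ℝ) ^ 2 / r * (u r) ^ 2

/-- The admissible class: `u` is absolutely continuous on `[0, R]`, vanishes at both end points,
and has finite energy. The energy density is measurable and nonnegative on `(0, R)`, so
integrability says that the energy integral is finite. Values of `u` outside `[0, R]` play
no role. -/
def admissible (m : ℤ) (R : ℝ) : Set (ℝ → ℝ) :=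
  {u | AbsolutelyContinuousOnInterval u 0 R ∧ u 0 = 0 ∧ u R = 0 ∧
    IntegrableOn (energyDensity m u) (Ioo 0 R)}

/-- The action functional
`I(u) = 1/2 ∫_0^R (r u_r ^ 2 + (m ^ 2 / r) u ^ 2 + (r / α) ln (1 + α u ^ 2)) dr`. -/
def action (m : ℤ) (α R : ℝ) (u : ℝ → ℝ) : ℝ :=
  (1 / 2) * ∫ r in Ioo 0 R,
    (r * (deriv u r) ^ 2 + (m : ℝ) ^ 2 / r * (u r) ^ 2
      + r / α * Real.log (1 + α * (u r) ^ 2))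

/-- The energy flux `P(u) = 2 π ∫_0^R r u ^ 2 dr`. -/
def flux (R : ℝ) (u : ℝ → ℝ) : ℝ :=
  2 * Real.pi * ∫ r in Ioo 0 R, r * (u r) ^ 2

/-- The admissible functions with energy flux `P₀`. -/
def feasible (m : ℤ) (R P₀ : ℝ) : Set (ℝ → ℝ) :=
  {u | u ∈ admissible m R ∧ flux R u = P₀}

/-- `u` solves the constrained minimization problem `I(u) = inf {I(w) | w admissible, P(w) = P₀}`:
it is feasible and the infimum is attained at `u`. -/
def IsMinimizer (m : ℤ) (α R P₀ : ℝ) (u : ℝ → ℝ) : Prop :=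
  u ∈ feasible m R P₀ ∧ IsMinOn (action m α R) (feasible m R P₀) u

/-- `u` is a positive classical solution, with propagation constant `β`, of
`(r u_r)_r - (m ^ 2 / r) u - r u / (1 + α u ^ 2) = β r u` on `(0, R)`, `u(0) = u(R) = 0`:
it is `C²` on the closed interval `[0, R]` (one-sided at the end points), positive on `(0, R)`,
and satisfies the equation at every point of `(0, R)`. -/
structure IsPositiveSolution (m : ℤ) (α R β : ℝ) (u : ℝ → ℝ) : Prop where
  contDiffOn : ContDiffOn ℝ 2 u (Icc 0 R)
  left_zero : u 0 = 0
  right_zero : u R = 0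
  pos : ∀ r ∈ Ioo 0 R, 0 < u r
  equation : ∀ r ∈ Ioo 0 R,
    deriv (fun s => s * deriv u s) r - (m : ℝ) ^ 2 / r * u r
      - r * u r / (1 + α * (u r) ^ 2) = β * r * u r

/-- `lam` is a Lagrange multiplier at `u` for the action under the flux constraint: in every
admissible direction `v`, both functionals have a directional derivative at `u`, and
`⟨I'(u), v⟩ = lam * ⟨P'(u), v⟩`. -/
def IsLagrangeMultiplier (m : ℤ) (α R : ℝ) (u : ℝ → ℝ) (lam : ℝ) : Prop :=
  ∀ v ∈ admissible m R, ∃ dI dP : ℝ,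
    HasLineDerivAt ℝ (action m α R) dI u v ∧ HasLineDerivAt ℝ (flux R) dP u v ∧ dI = lam * dP

end

end PhotorefractiveSoliton

/-!
# Minimizers of the radial photorefractive action under a flux constraint

The direct method gives a minimizer, but not at once in the admissible class: a bound on
`∫ r u_r ^ 2` does not keep `u_r` integrable near `0`, so absolute continuity up to `0` may be lost
in a weak limit. The minimization is therefore carried out in the larger class `relaxed`, where
absolute continuity is required on `[a, R]` for `a > 0` only. Along a minimizing sequence `√r u_r` is
bounded in `L²(0, R)`. A weakly convergent subsequence converges pointwise on `(0, R)`, because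
evaluation at `r` is the inner product with a fixed function; the flux and the logarithmic term
converge since `r u ^ 2` is uniformly bounded, and the energy is lower semicontinuous
(`exists_relaxed_minimizer`).

The Euler–Lagrange identity uses concavity of the logarithm: the action is dominated by the
quadratic functional whose potential is frozen at `u`, with equality at `u`. So `u` also minimizes a
quadratic form under a quadratic constraint; by homogeneity a shifted form is nonnegative along
every line `u + t v` and vanishes at `t = 0`, which kills its linear term
(`energyForm_eq_zero_of_isMin`). The same bounds on the logarithm give the directional derivatives.

A weak solution is compared on `[a, R]` with the classical solution of the linear equation that has
the same boundary values, which makes it `C²` away from `0`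
(`exists_eq_integral_of_energyForm_eq_zero`). At the singular end point, with `k = |m|`, the identity
`(r ^ (2 k + 1) (u / r ^ k)_r)_r = r ^ (k + 1) q u` improves the decay of `u` one power at a time up to
`u = O(r ^ k)`, and then shows that `u_rr` has a limit at `0`
(`singular_endpoint_asymptotics`, `contDiffOn_of_weak`). In particular a relaxed minimizer is
admissible. Its absolute value is again an admissible minimizer, and a nonnegative minimizer has no
interior zero, by uniqueness for the linear initial value problem (`pos_of_weak`).
-/

namespace PhotorefractiveSoliton

open Filter Topology


/-! ### Elementary bounds for the logarithmic nonlinearity -/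

/-- Tangent line bound: `s ↦ log (1 + α s)` is concave. -/
lemma log_one_add_mul_sub_le {α a b : ℝ} (hα : 0 < α) (ha : 0 ≤ a) (hb : 0 ≤ b) :
    Real.log (1 + α * b) - Real.log (1 + α * a) ≤ α * (b - a) / (1 + α * a) := by
  have h1 : 0 < 1 + α * a := by positivity
  have h2 : 0 < 1 + α * b := by positivity
  rw [← Real.log_div h2.ne' h1.ne']
  refine (Real.log_le_sub_one_of_pos (by positivity)).trans_eq ?_
  field_simp
  ring

/-- First order Taylor expansion of `x ↦ log (1 + α x ^ 2)` with a uniform quadratic remainder. -/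
lemma abs_log_one_add_mul_sq_sub_le {α : ℝ} (hα : 0 < α) (x h : ℝ) :
    |Real.log (1 + α * (x + h) ^ 2) - Real.log (1 + α * x ^ 2)
      - 2 * α * (x * h) / (1 + α * x ^ 2)| ≤ 2 * α * h ^ 2 := by
  have hA : 0 < 1 + α * x ^ 2 := by positivity
  have hB : 0 < 1 + α * (x + h) ^ 2 := by positivity
  have up := log_one_add_mul_sub_le hα (sq_nonneg x) (sq_nonneg (x + h))
  have lo := log_one_add_mul_sub_le hα (sq_nonneg (x + h)) (sq_nonneg x)
  have e1 : α * ((x + h) ^ 2 - x ^ 2) / (1 + α * x ^ 2)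
      = 2 * α * (x * h) / (1 + α * x ^ 2) + α * h ^ 2 / (1 + α * x ^ 2) := by
    rw [← add_div]; congr 1; ring
  have e2 : α * h ^ 2 / (1 + α * x ^ 2) ≤ α * h ^ 2 :=
    div_le_self (by positivity) (by nlinarith [sq_nonneg x])
  have e3 : 0 ≤ α * h ^ 2 / (1 + α * x ^ 2) := by positivity
  -- the two difference quotients differ by at most `2 α h ^ 2`,
  -- because `(b - a) ^ 2 ≤ 2 h ^ 2 (a + b)` for `a = x ^ 2`, `b = (x + h) ^ 2`
  have e4 : α * ((x + h) ^ 2 - x ^ 2) / (1 + α * x ^ 2)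
      - α * ((x + h) ^ 2 - x ^ 2) / (1 + α * (x + h) ^ 2) ≤ 2 * α * h ^ 2 := by
    rw [div_sub_div _ _ hA.ne' hB.ne', div_le_iff₀ (by positivity)]
    have : (x + h) ^ 2 - x ^ 2 = h * (2 * x + h) := by ring
    have key : (2 * x + h) ^ 2 ≤ 2 * (x ^ 2 + (x + h) ^ 2) := by nlinarith [sq_nonneg h]
    have k2 : α ^ 2 * h ^ 2 * (2 * x + h) ^ 2 ≤ α ^ 2 * h ^ 2 * (2 * (x ^ 2 + (x + h) ^ 2)) :=
      mul_le_mul_of_nonneg_left key (by positivity)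
    have k3 : 0 ≤ 2 * α * h ^ 2 * (1 + α * x ^ 2 * (α * (x + h) ^ 2)) := by positivity
    nlinarith
  rw [abs_le]
  have e5 : α * (x ^ 2 - (x + h) ^ 2) / (1 + α * (x + h) ^ 2)
      = - (α * ((x + h) ^ 2 - x ^ 2) / (1 + α * (x + h) ^ 2)) := by
    rw [← neg_div]; congr 1; ring
  have e6 : α * h ^ 2 ≥ 0 := by positivity
  constructor <;> linarith

lemma log_one_add_mul_sq_nonneg {α : ℝ} (hα : 0 < α) (x : ℝ) :
    0 ≤ Real.log (1 + α * x ^ 2) :=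
  Real.log_nonneg (by nlinarith [sq_nonneg x, mul_nonneg hα.le (sq_nonneg x)])

lemma log_one_add_mul_sq_le {α : ℝ} (hα : 0 < α) (x : ℝ) :
    Real.log (1 + α * x ^ 2) ≤ α * x ^ 2 := by
  simpa using log_one_add_mul_sub_le hα le_rfl (sq_nonneg x)

/-! ### The relaxed class -/

/-- The energy space: as `admissible`, but absolute continuity is only required away from the
singular end point `0`, and no value at `0` is prescribed. Finite energy does not make `u_r`
integrable near `0`, so it is this class, and not `admissible`, that is closed under weak limits
of bounded energy. -/
def relaxed (m : ℤ) (R : ℝ) : Set (ℝ → ℝ) :=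
  {u | (∀ a ∈ Ioo 0 R, AbsolutelyContinuousOnInterval u a R) ∧ u R = 0 ∧
    IntegrableOn (energyDensity m u) (Ioo 0 R)}

variable {m : ℤ} {α β R P₀ : ℝ} {u v w : ℝ → ℝ}

lemma admissible_subset_relaxed (m : ℤ) (R : ℝ) : admissible m R ⊆ relaxed m R := by
  rintro u ⟨h1, -, h3, h4⟩
  refine ⟨fun a ha => h1.mono ?_, h3, h4⟩
  rw [uIcc_of_le ha.2.le, uIcc_of_le (ha.1.trans ha.2).le]
  exact Icc_subset_Icc_left ha.1.le

lemma relaxed.continuousOn (hu : u ∈ relaxed m R) : ContinuousOn u (Ioo 0 R) := by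
  intro r hr
  have h := (hu.1 (r / 2) ⟨by linarith [hr.1], by linarith [hr.1, hr.2]⟩).continuousOn
  rw [uIcc_of_le (by linarith [hr.1, hr.2])] at h
  exact (h.continuousAt (Icc_mem_nhds (by linarith [hr.1]) hr.2)).continuousWithinAt

lemma relaxed.aestronglyMeasurable (hu : u ∈ relaxed m R) :
    AEStronglyMeasurable u (volume.restrict (Ioo 0 R)) :=
  (relaxed.continuousOn hu).aestronglyMeasurable measurableSet_Ioo

lemma ae_restrict_Ioo_of_forall {R : ℝ} {p : ℝ → Prop}
    (h : ∀ a ∈ Ioo 0 R, ∀ᵐ r ∂(volume.restrict (Ioo a R)), p r) :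
    ∀ᵐ r ∂(volume.restrict (Ioo 0 R)), p r := by
  rw [ae_restrict_iff' measurableSet_Ioo]
  have h' : ∀ n : ℕ, ∀ᵐ r, R / (n + 2) < R → 0 < R / (n + 2) → r ∈ Ioo (R / (n + 2)) R → p r := by
    intro n
    by_cases hn : 0 < R / (n + 2) ∧ R / (n + 2) < R
    · have := h _ hn
      rw [ae_restrict_iff' measurableSet_Ioo] at this
      filter_upwards [this] with r hr _ _ h using hr h
    · filter_upwards with r h1 h2
      exact absurd ⟨h2, h1⟩ hn
  filter_upwards [ae_all_iff.2 h'] with r hr hrR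
  have hR : 0 < R := hrR.1.trans hrR.2
  obtain ⟨n, hn⟩ := exists_nat_gt (R / r)
  have hn2 : (0:ℝ) < n + 2 := by positivity
  have hn0 : (0:ℝ) ≤ n := Nat.cast_nonneg n
  refine hr n (div_lt_self hR (by linarith)) (by positivity) ⟨?_, hrR.2⟩
  rw [div_lt_iff₀ hn2]
  rw [div_lt_iff₀ hrR.1] at hn
  nlinarith [hrR.1]

lemma relaxed.ae_differentiableAt (hu : u ∈ relaxed m R) :
    ∀ᵐ r ∂(volume.restrict (Ioo 0 R)), DifferentiableAt ℝ u r := by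
  refine ae_restrict_Ioo_of_forall fun a ha => ?_
  rw [ae_restrict_iff' measurableSet_Ioo]
  have := (hu.1 a ha).ae_differentiableAt
  rw [uIcc_of_le ha.2.le] at this
  filter_upwards [this] with r hr h using hr (Ioo_subset_Icc_self h)

lemma aestronglyMeasurable_deriv (u : ℝ → ℝ) (μ : Measure ℝ) :
    AEStronglyMeasurable (deriv u) μ :=
  (measurable_deriv u).aestronglyMeasurable

lemma relaxed.integrableOn_kinetic (hu : u ∈ relaxed m R) :
    IntegrableOn (fun r => r * deriv u r ^ 2) (Ioo 0 R) := by
  refine Integrable.mono' hu.2.2 ?_ ?_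
  · exact continuous_id.aestronglyMeasurable.mul ((aestronglyMeasurable_deriv u _).pow 2)
  · filter_upwards [ae_restrict_mem measurableSet_Ioo] with r hr
    have := hr.1
    rw [Real.norm_of_nonneg (by positivity)]
    have : 0 ≤ (m : ℝ) ^ 2 / r * u r ^ 2 := by positivity
    simp only [energyDensity]; linarith

lemma relaxed.integrableOn_centrifugal (hu : u ∈ relaxed m R) :
    IntegrableOn (fun r => (m : ℝ) ^ 2 / r * u r ^ 2) (Ioo 0 R) := by
  refine Integrable.mono' hu.2.2 ?_ ?_
  · exact (measurable_const.div measurable_id).aestronglyMeasurable.mul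
      ((relaxed.aestronglyMeasurable hu).pow 2)
  · filter_upwards [ae_restrict_mem measurableSet_Ioo] with r hr
    have := hr.1
    rw [Real.norm_of_nonneg (by positivity)]
    have : 0 ≤ r * deriv u r ^ 2 := by positivity
    simp only [energyDensity]; linarith

lemma one_le_sq_of_ne_zero (hm : m ≠ 0) : (1 : ℝ) ≤ (m : ℝ) ^ 2 := by
  have : (1 : ℤ) ≤ m ^ 2 := by have := sq_pos_of_ne_zero hm; omega
  exact_mod_cast this

lemma relaxed.integrableOn_mass (hm : m ≠ 0) (hu : u ∈ relaxed m R) :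
    IntegrableOn (fun r => r * u r ^ 2) (Ioo 0 R) := by
  refine Integrable.mono' ((relaxed.integrableOn_centrifugal hu).const_mul (R ^ 2)) ?_ ?_
  · exact continuous_id.aestronglyMeasurable.mul ((relaxed.aestronglyMeasurable hu).pow 2)
  · filter_upwards [ae_restrict_mem measurableSet_Ioo] with r hr
    have hr0 := hr.1
    have hm1 := one_le_sq_of_ne_zero hm
    rw [Real.norm_of_nonneg (by positivity), ← mul_assoc]
    gcongr
    rw [mul_div_assoc', le_div_iff₀ hr0]
    nlinarith [hr.2, sq_nonneg R, mul_self_le_mul_self hr0.le hr.2.le]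

/-- A product of two functions is integrable if their weighted squares are. -/
lemma integrableOn_weight_mul {w f g : ℝ → ℝ} (hw : ∀ r ∈ Ioo 0 R, 0 ≤ w r)
    (hm : AEStronglyMeasurable (fun r => w r * (f r * g r)) (volume.restrict (Ioo 0 R)))
    (hf : IntegrableOn (fun r => w r * f r ^ 2) (Ioo 0 R))
    (hg : IntegrableOn (fun r => w r * g r ^ 2) (Ioo 0 R)) :
    IntegrableOn (fun r => w r * (f r * g r)) (Ioo 0 R) := by
  refine Integrable.mono' (hf.add hg) hm ?_
  filter_upwards [ae_restrict_mem measurableSet_Ioo] with r hr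
  rw [Real.norm_eq_abs, abs_mul, abs_of_nonneg (hw r hr), Pi.add_apply, ← mul_add]
  refine mul_le_mul_of_nonneg_left ?_ (hw r hr)
  rw [abs_le]
  constructor <;> nlinarith [sq_nonneg (f r + g r), sq_nonneg (f r - g r), sq_nonneg (f r),
    sq_nonneg (g r)]

lemma relaxed.integrableOn_kinetic_mul (hu : u ∈ relaxed m R) (hv : v ∈ relaxed m R) :
    IntegrableOn (fun r => r * (deriv u r * deriv v r)) (Ioo 0 R) :=
  integrableOn_weight_mul (fun _ hr => hr.1.le)
    (continuous_id.aestronglyMeasurable.mul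
      ((aestronglyMeasurable_deriv u _).mul (aestronglyMeasurable_deriv v _)))
    (relaxed.integrableOn_kinetic hu) (relaxed.integrableOn_kinetic hv)

lemma relaxed.integrableOn_centrifugal_mul (hu : u ∈ relaxed m R) (hv : v ∈ relaxed m R) :
    IntegrableOn (fun r => (m : ℝ) ^ 2 / r * (u r * v r)) (Ioo 0 R) :=
  integrableOn_weight_mul (fun _ hr => div_nonneg (sq_nonneg _) hr.1.le)
    ((measurable_const.div measurable_id).aestronglyMeasurable.mul
      ((relaxed.aestronglyMeasurable hu).mul (relaxed.aestronglyMeasurable hv)))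
    (relaxed.integrableOn_centrifugal hu) (relaxed.integrableOn_centrifugal hv)

lemma relaxed.integrableOn_mass_mul (hm : m ≠ 0) (hu : u ∈ relaxed m R) (hv : v ∈ relaxed m R) :
    IntegrableOn (fun r => r * (u r * v r)) (Ioo 0 R) :=
  integrableOn_weight_mul (fun _ hr => hr.1.le)
    (continuous_id.aestronglyMeasurable.mul
      ((relaxed.aestronglyMeasurable hu).mul (relaxed.aestronglyMeasurable hv)))
    (relaxed.integrableOn_mass hm hu) (relaxed.integrableOn_mass hm hv)

lemma relaxed.ae_deriv_add_smul (hu : u ∈ relaxed m R) (hv : v ∈ relaxed m R) (t : ℝ) :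
    ∀ᵐ r ∂(volume.restrict (Ioo 0 R)), deriv (u + t • v) r = deriv u r + t * deriv v r := by
  filter_upwards [relaxed.ae_differentiableAt hu, relaxed.ae_differentiableAt hv] with r h1 h2
  exact (h1.hasDerivAt.add (h2.hasDerivAt.const_smul t)).deriv

lemma deriv_smul_apply (c : ℝ) (u : ℝ → ℝ) (r : ℝ) : deriv (c • u) r = c * deriv u r := by
  rw [deriv_const_smul_field]; rfl

lemma relaxed.add_smul_mem (hu : u ∈ relaxed m R) (hv : v ∈ relaxed m R) (t : ℝ) :
    u + t • v ∈ relaxed m R := by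
  refine ⟨fun a ha => (hu.1 a ha).add ((hv.1 a ha).const_smul t), ?_, ?_⟩
  · simp [hu.2.1, hv.2.1]
  · have h1 := (hu.2.2.add (((relaxed.integrableOn_kinetic_mul hu hv).add
      (relaxed.integrableOn_centrifugal_mul hu hv)).const_mul (2 * t))).add
      (hv.2.2.const_mul (t ^ 2))
    refine h1.congr ?_
    filter_upwards [relaxed.ae_deriv_add_smul hu hv t] with r hr
    simp only [energyDensity, Pi.add_apply, Pi.smul_apply, smul_eq_mul, hr]
    ring

lemma relaxed.smul_mem (hu : u ∈ relaxed m R) (c : ℝ) : c • u ∈ relaxed m R := by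
  refine ⟨fun a ha => (hu.1 a ha).const_smul c, by simp [hu.2.1], ?_⟩
  refine (hu.2.2.const_mul (c ^ 2)).congr (Eventually.of_forall fun r => ?_)
  simp only [energyDensity, deriv_smul_apply, Pi.smul_apply, smul_eq_mul]
  ring

lemma admissible.add_smul_mem (hu : u ∈ admissible m R) (hv : v ∈ admissible m R) (t : ℝ) :
    u + t • v ∈ admissible m R :=
  ⟨hu.1.add (hv.1.const_smul t), by simp [hu.2.1, hv.2.1], by simp [hu.2.2.1, hv.2.2.1],
    (relaxed.add_smul_mem (admissible_subset_relaxed m R hu)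
      (admissible_subset_relaxed m R hv) t).2.2⟩

lemma admissible.smul_mem (hu : u ∈ admissible m R) (c : ℝ) : c • u ∈ admissible m R :=
  ⟨hu.1.const_smul c, by simp [hu.2.1], by simp [hu.2.2.1],
    (relaxed.smul_mem (admissible_subset_relaxed m R hu) c).2.2⟩

/-- Pointwise control of a finite energy function by its kinetic energy. -/
lemma relaxed.sqrt_mul_abs_le (hu : u ∈ relaxed m R) {r : ℝ} (hr : r ∈ Ioo 0 R) :
    √r * |u r| ≤ ((∫ s in Ioo 0 R, s * deriv u s ^ 2) + R) / 2 := by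
  have hac := hu.1 r hr
  have hR : 0 < R := hr.1.trans hr.2
  have h1 : u r = - ∫ s in r..R, deriv u s := by rw [hac.integral_deriv_eq_sub, hu.2.1]; ring
  have hint := hac.intervalIntegrable_deriv
  rw [intervalIntegrable_iff_integrableOn_Ioo_of_le hr.2.le] at hint
  rw [h1, abs_neg, intervalIntegral.integral_of_le hr.2.le, integral_Ioc_eq_integral_Ioo]
  have hsub : Ioo r R ⊆ Ioo 0 R := Ioo_subset_Ioo_left hr.1.le
  have hk := relaxed.integrableOn_kinetic hu
  have h2 : IntegrableOn (fun s => (s * deriv u s ^ 2 + 1) / 2) (Ioo 0 R) :=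
    (hk.add (integrableOn_const (by simp))).div_const 2
  calc √r * |∫ s in Ioo r R, deriv u s| ≤ √r * ∫ s in Ioo r R, |deriv u s| := by
        gcongr; exact abs_integral_le_integral_abs
    _ = ∫ s in Ioo r R, √r * |deriv u s| := (integral_const_mul _ _).symm
    _ ≤ ∫ s in Ioo r R, (s * deriv u s ^ 2 + 1) / 2 := by
        refine setIntegral_mono_on (hint.abs.const_mul _) (h2.mono_set hsub) measurableSet_Ioo
          fun s hs => ?_
        -- `2 √r |u_r| ≤ r u_r ^ 2 + 1` and `r ≤ s`
        have hsq : √r * √r = r := Real.mul_self_sqrt hr.1.le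
        have h3 : (√r * |deriv u s|) ^ 2 = r * deriv u s ^ 2 := by
          rw [mul_pow, sq_abs, sq, hsq]
        have h4 : r * deriv u s ^ 2 ≤ s * deriv u s ^ 2 := by
          gcongr; exact hs.1.le
        nlinarith [sq_nonneg (√r * |deriv u s| - 1)]
    _ ≤ ∫ s in Ioo 0 R, (s * deriv u s ^ 2 + 1) / 2 := by
        refine setIntegral_mono_set h2 ?_ (Filter.Eventually.of_forall hsub)
        filter_upwards [ae_restrict_mem measurableSet_Ioo] with s hs
        have := hs.1
        simp only [Pi.zero_apply]; positivity
    _ = _ := by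
        rw [integral_div, integral_add hk (integrableOn_const (by simp))]
        simp [hR.le]

/-! ### Quadratic forms and their expansion along lines -/

noncomputable section

/-- The bilinear form of the linear radial operator with potential `q`. -/
def energyForm (m : ℤ) (R : ℝ) (q u v : ℝ → ℝ) : ℝ :=
  ∫ r in Ioo 0 R, (r * (deriv u r * deriv v r) + (m : ℝ) ^ 2 / r * (u r * v r)
    + q r * (r * (u r * v r)))

/-- The inner product of `L²((0, R), r dr)`. -/
def massForm (R : ℝ) (u v : ℝ → ℝ) : ℝ := ∫ r in Ioo 0 R, r * (u r * v r)

end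

lemma integral_add_smul_add_smul {f g h : ℝ → ℝ} {s : Set ℝ} (hf : IntegrableOn f s)
    (hg : IntegrableOn g s) (hh : IntegrableOn h s) (a b : ℝ) :
    ∫ r in s, (f r + a * g r + b * h r)
      = (∫ r in s, f r) + a * (∫ r in s, g r) + b * ∫ r in s, h r := by
  have h1 : ∫ r in s, ((f + fun r => a * g r) r + b * h r)
      = (∫ r in s, (f + fun r => a * g r) r) + ∫ r in s, b * h r :=
    integral_add (hf.add (hg.const_mul a)) (hh.const_mul b)
  have h2 : ∫ r in s, (f + fun r => a * g r) r = (∫ r in s, f r) + ∫ r in s, a * g r :=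
    integral_add hf (hg.const_mul a)
  rw [← integral_const_mul, ← integral_const_mul, ← h2, ← h1]
  rfl

lemma flux_eq_massForm (R : ℝ) (u : ℝ → ℝ) : flux R u = 2 * Real.pi * massForm R u u := by
  simp only [flux, massForm, sq]

lemma massForm_add_smul (hm : m ≠ 0) (hu : u ∈ relaxed m R) (hv : v ∈ relaxed m R) (t : ℝ) :
    massForm R (u + t • v) (u + t • v)
      = massForm R u u + 2 * t * massForm R u v + t ^ 2 * massForm R v v := by
  have h1 := relaxed.integrableOn_mass_mul hm hu hu
  have h2 := relaxed.integrableOn_mass_mul hm hu hv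
  have h3 := relaxed.integrableOn_mass_mul hm hv hv
  simp only [massForm]
  rw [← integral_add_smul_add_smul h1 h2 h3]
  congr 1
  ext r
  simp only [Pi.add_apply, Pi.smul_apply, smul_eq_mul]
  ring

lemma massForm_smul (c : ℝ) (u : ℝ → ℝ) :
    massForm R (c • u) (c • u) = c ^ 2 * massForm R u u := by
  simp only [massForm]
  rw [← integral_const_mul]
  congr 1
  ext r
  simp only [Pi.smul_apply, smul_eq_mul]
  ring

lemma relaxed.integrableOn_energyForm (hm : m ≠ 0) (hu : u ∈ relaxed m R) (hv : v ∈ relaxed m R)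
    {q : ℝ → ℝ} {C : ℝ} (hq : AEStronglyMeasurable q (volume.restrict (Ioo 0 R)))
    (hC : ∀ r, |q r| ≤ C) :
    IntegrableOn (fun r => r * (deriv u r * deriv v r) + (m : ℝ) ^ 2 / r * (u r * v r)
      + q r * (r * (u r * v r))) (Ioo 0 R) :=
  ((relaxed.integrableOn_kinetic_mul hu hv).add (relaxed.integrableOn_centrifugal_mul hu hv)).add
    ((relaxed.integrableOn_mass_mul hm hu hv).bdd_mul hq (Eventually.of_forall hC))

lemma energyForm_add_smul (hm : m ≠ 0) (hu : u ∈ relaxed m R) (hv : v ∈ relaxed m R)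
    {q : ℝ → ℝ} {C : ℝ} (hq : AEStronglyMeasurable q (volume.restrict (Ioo 0 R)))
    (hC : ∀ r, |q r| ≤ C) (t : ℝ) :
    energyForm m R q (u + t • v) (u + t • v)
      = energyForm m R q u u + 2 * t * energyForm m R q u v
        + t ^ 2 * energyForm m R q v v := by
  have h1 := relaxed.integrableOn_energyForm hm hu hu hq hC
  have h2 := relaxed.integrableOn_energyForm hm hu hv hq hC
  have h3 := relaxed.integrableOn_energyForm hm hv hv hq hC
  simp only [energyForm]
  rw [← integral_add_smul_add_smul h1 h2 h3]
  refine integral_congr_ae ?_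
  filter_upwards [relaxed.ae_deriv_add_smul hu hv t] with r hr
  simp only [Pi.add_apply, Pi.smul_apply, smul_eq_mul, hr]
  ring

lemma energyForm_smul (q : ℝ → ℝ) (c : ℝ) (u : ℝ → ℝ) :
    energyForm m R q (c • u) (c • u) = c ^ 2 * energyForm m R q u u := by
  simp only [energyForm]
  rw [← integral_const_mul]
  congr 1
  ext r
  simp only [deriv_smul_apply, Pi.smul_apply, smul_eq_mul]
  ring

lemma energyForm_add_const (hm : m ≠ 0) (hu : u ∈ relaxed m R) (hv : v ∈ relaxed m R)
    {q : ℝ → ℝ} {C : ℝ} (hq : AEStronglyMeasurable q (volume.restrict (Ioo 0 R)))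
    (hC : ∀ r, |q r| ≤ C) (β : ℝ) :
    energyForm m R (fun r => q r + β) u v = energyForm m R q u v + β * massForm R u v := by
  have h1 := relaxed.integrableOn_energyForm hm hu hv hq hC
  have h2 := relaxed.integrableOn_mass_mul hm hu hv
  simp only [energyForm, massForm]
  rw [← integral_const_mul, ← integral_add h1 (h2.const_mul _)]
  congr 1
  ext r
  ring

/-! ### The Euler–Lagrange identity and the directional derivatives -/

noncomputable section

/-- The saturable potential `1 / (1 + α u ^ 2)` generated by `u`. -/
def saturation (α : ℝ) (u : ℝ → ℝ) (r : ℝ) : ℝ := 1 / (1 + α * u r ^ 2)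

/-- The propagation constant forced by testing the equation with `u` itself. -/
def propagationConstant (m : ℤ) (α R : ℝ) (u : ℝ → ℝ) : ℝ :=
  -energyForm m R (saturation α u) u u / massForm R u u

end

lemma saturation_pos (hα : 0 < α) (u : ℝ → ℝ) (r : ℝ) : 0 < saturation α u r := by
  unfold saturation; positivity

lemma abs_saturation_le (hα : 0 < α) (u : ℝ → ℝ) (r : ℝ) : |saturation α u r| ≤ 1 := by
  rw [abs_of_pos (saturation_pos hα u r), saturation]
  exact div_le_one_of_le₀ (by nlinarith [mul_nonneg hα.le (sq_nonneg (u r))]) (by positivity)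

lemma relaxed.aestronglyMeasurable_saturation (hu : u ∈ relaxed m R) (α : ℝ) :
    AEStronglyMeasurable (saturation α u) (volume.restrict (Ioo 0 R)) := by
  have h := (relaxed.aestronglyMeasurable hu).aemeasurable
  exact (((h.pow_const 2).const_mul α).const_add 1).const_div 1 |>.aestronglyMeasurable

lemma relaxed.integrableOn_log (hm : m ≠ 0) (hα : 0 < α) (hu : u ∈ relaxed m R) :
    IntegrableOn (fun r => r / α * Real.log (1 + α * u r ^ 2)) (Ioo 0 R) := by
  refine Integrable.mono' (relaxed.integrableOn_mass hm hu) ?_ ?_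
  · have h := (relaxed.aestronglyMeasurable hu).aemeasurable
    exact ((aemeasurable_id.div_const α).mul
      (Real.measurable_log.comp_aemeasurable
        (((h.pow_const 2).const_mul α).const_add 1))).aestronglyMeasurable
  · filter_upwards [ae_restrict_mem measurableSet_Ioo] with r hr
    have h1 := log_one_add_mul_sq_nonneg hα (u r)
    have h2 := log_one_add_mul_sq_le hα (u r)
    have hr0 := hr.1
    rw [Real.norm_of_nonneg (by positivity), div_mul_eq_mul_div, div_le_iff₀ hα]
    nlinarith

lemma relaxed.integrableOn_action (hm : m ≠ 0) (hα : 0 < α) (hu : u ∈ relaxed m R) :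
    IntegrableOn (fun r => r * (deriv u r) ^ 2 + (m : ℝ) ^ 2 / r * (u r) ^ 2
      + r / α * Real.log (1 + α * (u r) ^ 2)) (Ioo 0 R) :=
  hu.2.2.add (relaxed.integrableOn_log hm hα hu)

/-- By concavity of the logarithm, the action lies below the quadratic functional obtained by
freezing the potential at `u`, and touches it at `u`. -/
lemma action_sub_action_le (hm : m ≠ 0) (hα : 0 < α) (hu : u ∈ relaxed m R)
    (hw : w ∈ relaxed m R) :
    action m α R w - action m α R u ≤
      1 / 2 * (energyForm m R (saturation α u) w w - energyForm m R (saturation α u) u u) := by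
  have hq := relaxed.aestronglyMeasurable_saturation hu α
  have hC := abs_saturation_le hα u
  have f1 := relaxed.integrableOn_energyForm hm hw hw hq hC
  have f2 := relaxed.integrableOn_energyForm hm hu hu hq hC
  have a1 := relaxed.integrableOn_action hm hα hw
  have a2 := relaxed.integrableOn_action hm hα hu
  simp only [action, energyForm]
  rw [← mul_sub, ← integral_sub a1 a2, ← integral_sub f1 f2]
  refine mul_le_mul_of_nonneg_left ?_ (by norm_num)
  refine setIntegral_mono_on (a1.sub a2) (f1.sub f2) measurableSet_Ioo fun r hr => ?_
  have h := log_one_add_mul_sub_le hα (sq_nonneg (u r)) (sq_nonneg (w r))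
  have h2 : r / α * (Real.log (1 + α * w r ^ 2) - Real.log (1 + α * u r ^ 2)) ≤
      r / α * (α * (w r ^ 2 - u r ^ 2) / (1 + α * u r ^ 2)) :=
    mul_le_mul_of_nonneg_left h (div_nonneg hr.1.le hα.le)
  have h3 : r / α * (α * (w r ^ 2 - u r ^ 2) / (1 + α * u r ^ 2))
      = saturation α u r * (r * (w r * w r)) - saturation α u r * (r * (u r * u r)) := by
    have : 0 < 1 + α * u r ^ 2 := by positivity
    unfold saturation
    field_simp
  nlinarith

lemma massForm_self_nonneg (R : ℝ) (u : ℝ → ℝ) : 0 ≤ massForm R u u :=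
  setIntegral_nonneg measurableSet_Ioo fun _ hr => mul_nonneg hr.1.le (mul_self_nonneg _)

lemma energyForm_self_nonneg {q : ℝ → ℝ} (hq : ∀ r, 0 ≤ q r) (u : ℝ → ℝ) :
    0 ≤ energyForm m R q u u :=
  setIntegral_nonneg measurableSet_Ioo fun r hr => by
    have h1 := mul_nonneg hr.1.le (mul_self_nonneg (deriv u r))
    have h2 := mul_nonneg (div_nonneg (sq_nonneg (m : ℝ)) hr.1.le) (mul_self_nonneg (u r))
    have h3 := mul_nonneg (hq r) (mul_nonneg hr.1.le (mul_self_nonneg (u r)))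
    linarith

/-- A real quadratic polynomial without constant term that is nonnegative everywhere has no
linear term. -/
lemma eq_zero_of_forall_quadratic_nonneg {b c : ℝ} (h : ∀ t : ℝ, 0 ≤ 2 * t * b + t ^ 2 * c) :
    b = 0 := by
  have h1 := discrim_le_zero (a := c) (b := 2 * b) (c := 0) fun t => by linarith [h t]
  rw [discrim] at h1
  nlinarith [sq_nonneg b]

/-- **Euler–Lagrange identity.** It suffices that `u` minimizes the action among the multiples of
`u + t v` with the prescribed flux. -/
theorem energyForm_eq_zero_of_isMin (hm : m ≠ 0) (hα : 0 < α) (hP₀ : 0 < P₀)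
    (hu : u ∈ relaxed m R) (hv : v ∈ relaxed m R) (hP : flux R u = P₀)
    (hmin : ∀ c t : ℝ, flux R (c • (u + t • v)) = P₀ →
      action m α R u ≤ action m α R (c • (u + t • v))) :
    energyForm m R (fun r => saturation α u r + propagationConstant m α R u) u v = 0 := by
  have hq := relaxed.aestronglyMeasurable_saturation hu α
  have hC := abs_saturation_le hα u
  set β := propagationConstant m α R u with hβ
  have hM : 0 < massForm R u u := by
    rw [flux_eq_massForm] at hP
    exact pos_of_mul_pos_right (hP ▸ hP₀) (by positivity)
  have hqβ : AEStronglyMeasurable (fun r => saturation α u r + β) (volume.restrict (Ioo 0 R)) :=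
    hq.add aestronglyMeasurable_const
  have hCβ : ∀ r, |saturation α u r + β| ≤ 1 + |β| := fun r =>
    (abs_add_le _ _).trans (by gcongr; exact hC r)
  have hzero : energyForm m R (fun r => saturation α u r + β) u u = 0 := by
    rw [energyForm_add_const hm hu hu hq hC, hβ, propagationConstant]
    field_simp
    ring
  refine eq_zero_of_forall_quadratic_nonneg
    (c := energyForm m R (fun r => saturation α u r + β) v v) fun t => ?_
  have hexp := energyForm_add_smul hm hu hv hqβ hCβ t
  rw [hzero, zero_add] at hexp
  rw [← hexp]
  have hw := relaxed.add_smul_mem hu hv t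
  set w := u + t • v
  rw [energyForm_add_const hm hw hw hq hC]
  rcases (massForm_self_nonneg R w).eq_or_lt with h0 | hpos
  · rw [← h0, mul_zero, add_zero]
    exact energyForm_self_nonneg (fun r => (saturation_pos hα u r).le) w
  · -- rescale `w` to the prescribed flux
    set c := √(massForm R u u / massForm R w w)
    have hc : c ^ 2 = massForm R u u / massForm R w w := Real.sq_sqrt (by positivity)
    have hc0 : 0 < c ^ 2 := by rw [hc]; positivity
    have hcw : massForm R (c • w) (c • w) = massForm R u u := by
      rw [massForm_smul, hc]; field_simp
    have hfl : flux R (c • w) = P₀ := by rw [flux_eq_massForm, hcw, ← flux_eq_massForm, hP]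
    have h1 := hmin c t hfl
    have h2 := action_sub_action_le hm hα hu (relaxed.smul_mem hw c)
    rw [energyForm_smul] at h2
    rw [energyForm_add_const hm hu hu hq hC] at hzero
    rw [← hcw, massForm_smul] at hzero
    have h3 : 0 ≤ c ^ 2 * (energyForm m R (saturation α u) w w + β * massForm R w w) := by
      nlinarith
    exact nonneg_of_mul_nonneg_right h3 hc0

lemma hasDerivAt_zero_of_abs_sub_le {F : ℝ → ℝ} {d K : ℝ}
    (h : ∀ t, |F t - F 0 - t * d| ≤ K * t ^ 2) : HasDerivAt F d 0 := by
  rw [hasDerivAt_iff_isLittleO]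
  have h1 : (fun t => F t - F 0 - (t - 0) • d) =O[𝓝 0] fun t : ℝ => t ^ 2 :=
    Asymptotics.IsBigO.of_bound K (Eventually.of_forall fun t => by
      simpa [smul_eq_mul] using h t)
  simpa using h1.trans_isLittleO (Asymptotics.isLittleO_pow_id (n := 2) one_lt_two)

lemma hasLineDerivAt_flux (hm : m ≠ 0) (hu : u ∈ relaxed m R) (hv : v ∈ relaxed m R) :
    HasLineDerivAt ℝ (flux R) (4 * Real.pi * massForm R u v) u v := by
  refine hasDerivAt_zero_of_abs_sub_le (K := |2 * Real.pi * massForm R v v|) fun t => ?_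
  simp only [flux_eq_massForm, massForm_add_smul hm hu hv]
  rw [← abs_of_nonneg (sq_nonneg t), ← abs_mul]
  refine le_of_eq (congrArg _ ?_)
  rw [abs_of_nonneg (sq_nonneg t)]
  ring

lemma hasLineDerivAt_action (hm : m ≠ 0) (hα : 0 < α) (hu : u ∈ relaxed m R)
    (hv : v ∈ relaxed m R) :
    HasLineDerivAt ℝ (action m α R) (energyForm m R (saturation α u) u v) u v := by
  refine hasDerivAt_zero_of_abs_sub_le
    (K := ∫ r in Ioo 0 R, (1 / 2 * energyDensity m v r + r * v r ^ 2)) fun t => ?_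
  have hw := relaxed.add_smul_mem hu hv t
  have hq := relaxed.aestronglyMeasurable_saturation hu α
  have hC := abs_saturation_le hα u
  have a1 := (relaxed.integrableOn_action hm hα hw).const_mul (1 / 2)
  have a2 := (relaxed.integrableOn_action hm hα hu).const_mul (1 / 2)
  have f1 := (relaxed.integrableOn_energyForm hm hu hv hq hC).const_mul t
  have hK := ((hv.2.2.const_mul (1 / 2)).add (relaxed.integrableOn_mass hm hv)).const_mul (t ^ 2)
  rw [zero_smul, add_zero]
  simp only [action, energyForm]
  have hsub := integral_sub (a1.sub a2) f1
  simp only [Pi.sub_apply] at hsub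
  rw [← integral_const_mul, ← integral_const_mul, ← integral_const_mul, ← integral_sub a1 a2,
    ← hsub, mul_comm, ← integral_const_mul, ← Real.norm_eq_abs]
  refine norm_integral_le_of_norm_le hK ?_
  filter_upwards [relaxed.ae_deriv_add_smul hu hv t, ae_restrict_mem measurableSet_Ioo] with r hd hr
  rw [hd]
  simp only [Pi.add_apply, Pi.smul_apply, smul_eq_mul, energyDensity]
  have hlog := abs_log_one_add_mul_sq_sub_le hα (u r) (t * v r)
  set L := Real.log (1 + α * (u r + t * v r) ^ 2)
  set L₀ := Real.log (1 + α * u r ^ 2)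
  have e : 1 / 2 * (r * (deriv u r + t * deriv v r) ^ 2 + (m : ℝ) ^ 2 / r * (u r + t * v r) ^ 2
        + r / α * L) - 1 / 2 * (r * deriv u r ^ 2 + (m : ℝ) ^ 2 / r * u r ^ 2 + r / α * L₀)
        - t * (r * (deriv u r * deriv v r) + (m : ℝ) ^ 2 / r * (u r * v r)
          + saturation α u r * (r * (u r * v r)))
      = t ^ 2 * (1 / 2 * (r * deriv v r ^ 2 + (m : ℝ) ^ 2 / r * v r ^ 2))
        + r / (2 * α) * (L - L₀ - 2 * α * (u r * (t * v r)) / (1 + α * u r ^ 2)) := by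
    have : 0 < 1 + α * u r ^ 2 := by positivity
    unfold saturation
    have hr0 := hr.1.ne'
    field_simp
    ring
  rw [e, Real.norm_eq_abs]
  have hr0 := hr.1
  refine (abs_add_le _ _).trans ?_
  rw [abs_of_nonneg (by positivity), abs_mul (r / (2 * α)), abs_of_nonneg (by positivity),
    mul_add (t ^ 2) _ (r * v r ^ 2)]
  refine add_le_add le_rfl ?_
  calc _ ≤ r / (2 * α) * (2 * α * (t * v r) ^ 2) := by gcongr
    _ = _ := by field_simp

/-- The Euler–Lagrange identity in all admissible directions is the multiplier rule. -/
lemma isLagrangeMultiplier_of_energyForm_eq_zero (hm : m ≠ 0) (hα : 0 < α)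
    (hu : u ∈ relaxed m R) {β : ℝ}
    (h : ∀ v ∈ admissible m R, energyForm m R (fun r => saturation α u r + β) u v = 0) :
    IsLagrangeMultiplier m α R u (-β / (4 * Real.pi)) := by
  intro v hv
  have hv' := admissible_subset_relaxed m R hv
  refine ⟨_, _, hasLineDerivAt_action hm hα hu hv', hasLineDerivAt_flux hm hu hv', ?_⟩
  have h1 := h v hv
  rw [energyForm_add_const hm hu hv' (relaxed.aestronglyMeasurable_saturation hu α)
    (abs_saturation_le hα u)] at h1
  have : Real.pi ≠ 0 := Real.pi_ne_zero
  field_simp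
  linarith

/-! ### From the weak equation to the integrated equation -/

lemma relaxed.continuousOn_Ioc (hu : u ∈ relaxed m R) : ContinuousOn u (Ioc 0 R) := by
  intro r hr
  have h := (hu.1 (r / 2) ⟨by linarith [hr.1], by linarith [hr.1, hr.2]⟩).continuousOn
  rw [uIcc_of_le (by linarith [hr.1, hr.2])] at h
  refine (h r ⟨by linarith [hr.1], hr.2⟩).mono_of_mem_nhdsWithin ?_
  filter_upwards [self_mem_nhdsWithin,
    mem_nhdsWithin_of_mem_nhds (Ioi_mem_nhds (show r / 2 < r by linarith [hr.1]))] with s hs hs2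
  exact ⟨(mem_Ioi.1 hs2).le, hs.2⟩

/-- Primitives of interval integrable functions have that function as derivative almost
everywhere. -/
lemma ae_deriv_integral_eq {f : ℝ → ℝ} {a b c : ℝ} (hab : a ≤ b)
    (hf : IntervalIntegrable f volume a b) (hc : c ∈ Icc a b) :
    ∀ᵐ x ∂(volume.restrict (Ioo a b)), deriv (fun x => ∫ s in c..x, f s) x = f x := by
  rw [ae_restrict_iff' measurableSet_Ioo]
  filter_upwards [hf.ae_hasDerivAt_integral] with x hx hxI
  rw [uIcc_of_le hab] at hx
  exact (hx (Ioo_subset_Icc_self hxI) c hc).deriv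

/-- A weak solution satisfies the twice integrated equation. On `[a, R]` the function `u` is compared
with the classical solution `U` of the linear problem that has the same boundary values; testing
with `u - U`, extended by zero to `[0, a]`, gives `∫ r (u - U)_r ^ 2 = 0`. -/
theorem exists_eq_integral_of_energyForm_eq_zero (hu : u ∈ relaxed m R) {q : ℝ → ℝ}
    (hq : ContinuousOn q (Ioc 0 R))
    (h : ∀ v ∈ admissible m R, energyForm m R q u v = 0) {a : ℝ} (ha : a ∈ Ioo 0 R) :
    ∃ c, ∀ r ∈ Icc a R, u r = ∫ s in R..r,
      ((∫ x in R..s, ((m : ℝ) ^ 2 / x + q x * x) * u x) + c) / s := by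
  obtain ⟨ha0, haR⟩ := ha
  have hR : 0 < R := ha0.trans haR
  set F : ℝ → ℝ := fun x => ((m : ℝ) ^ 2 / x + q x * x) * u x with hF
  have hsub : Icc a R ⊆ Ioc 0 R := fun x hx => ⟨ha0.trans_le hx.1, hx.2⟩
  have huc := (relaxed.continuousOn_Ioc hu).mono hsub
  have hne : ∀ x ∈ Icc a R, x ≠ 0 := fun x hx => (hsub hx).1.ne'
  have hFc : ContinuousOn F (Icc a R) :=
    ((continuousOn_const.div continuousOn_id hne).add
      ((hq.mono hsub).mul continuousOn_id)).mul huc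
  have hFi : IntervalIntegrable F volume a R := by
    apply ContinuousOn.intervalIntegrable; rwa [uIcc_of_le haR.le]
  have hRmem : R ∈ uIcc a R := right_mem_uIcc
  have hHac := hFi.absolutelyContinuousOnInterval_intervalIntegral hRmem
  set H : ℝ → ℝ := fun s => ∫ x in R..s, F x with hH
  have hHc : ContinuousOn H (Icc a R) := by
    have := hHac.continuousOn; rwa [uIcc_of_le haR.le] at this
  -- choose the constant so that the classical solution takes the value `u a` at `a`
  have hinv : ContinuousOn (fun s : ℝ => s⁻¹) (Icc a R) := continuousOn_id.inv₀ hne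
  have hI1 : IntervalIntegrable (fun s => H s / s) volume R a := by
    apply ContinuousOn.intervalIntegrable
    rw [uIcc_of_ge haR.le]; exact hHc.div continuousOn_id hne
  have hI2 : IntervalIntegrable (fun s : ℝ => s⁻¹) volume R a := by
    apply ContinuousOn.intervalIntegrable; rwa [uIcc_of_ge haR.le]
  have hlog : ∫ s in R..a, s⁻¹ ≠ 0 := by
    rw [integral_inv_of_pos hR ha0]
    exact (Real.log_neg (by positivity) ((div_lt_one hR).2 haR)).ne
  set c : ℝ := (u a - ∫ s in R..a, H s / s) / ∫ s in R..a, s⁻¹ with hc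
  refine ⟨c, ?_⟩
  have hpc : ContinuousOn (fun s => (H s + c) / s) (Icc a R) :=
    (hHc.add continuousOn_const).div continuousOn_id hne
  have hpi : IntervalIntegrable (fun s => (H s + c) / s) volume a R := by
    apply ContinuousOn.intervalIntegrable; rwa [uIcc_of_le haR.le]
  have hUa : ∫ s in R..a, (H s + c) / s = u a := by
    have : ∀ s, (H s + c) / s = H s / s + c * s⁻¹ := fun s => by rw [add_div]; rfl
    simp_rw [this]
    rw [intervalIntegral.integral_add hI1 (hI2.const_mul c), intervalIntegral.integral_const_mul,
      hc, div_mul_cancel₀ _ hlog]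
    ring
  -- the test function
  have hac := hu.1 a ⟨ha0, haR⟩
  have hψ₀ : IntervalIntegrable (fun s => deriv u s - (H s + c) / s) volume a R :=
    hac.intervalIntegrable_deriv.sub hpi
  set ψ₀ : ℝ → ℝ := fun s => deriv u s - (H s + c) / s with hψ₀d
  set ψ : ℝ → ℝ := (Ioo a R).indicator ψ₀ with hψ
  have hψint : Integrable ψ := by
    rw [integrable_indicator_iff measurableSet_Ioo]
    rwa [intervalIntegrable_iff_integrableOn_Ioo_of_le haR.le] at hψ₀
  set φ : ℝ → ℝ := fun r => ∫ s in 0..r, ψ s with hφ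
  have hφ0 : ∀ r ∈ Icc 0 a, φ r = 0 := by
    intro r hr
    have : ∀ s ∈ uIcc 0 r, ψ s = 0 := fun s hs => by
      rw [uIcc_of_le hr.1] at hs
      exact indicator_of_notMem (fun hs' => absurd hs'.1 (not_lt.2 (hs.2.trans hr.2))) _
    simp only [hφ]
    rw [intervalIntegral.integral_congr (g := fun _ => 0) this]
    simp
  have hφ1 : ∀ r ∈ Icc a R, φ r = u r - ∫ s in R..r, (H s + c) / s := by
    intro r hr
    have hsplit : φ r = φ a + ∫ s in a..r, ψ s :=
      (intervalIntegral.integral_add_adjacent_intervals hψint.intervalIntegrable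
        hψint.intervalIntegrable).symm
    have hsubr : uIcc a r ⊆ uIcc a R := by
      rw [uIcc_of_le hr.1, uIcc_of_le haR.le]; exact Icc_subset_Icc_right hr.2
    have hψeq : ∫ s in a..r, ψ s = ∫ s in a..r, ψ₀ s := by
      apply intervalIntegral.integral_congr_ae
      have : ∀ᵐ s : ℝ, s ≠ R := by simp [ae_iff, measure_singleton]
      filter_upwards [this] with s hs hsr
      rw [uIoc_of_le hr.1] at hsr
      have hmem : s ∈ Ioo a R := ⟨hsr.1, lt_of_le_of_ne (hsr.2.trans hr.2) hs⟩
      exact indicator_of_mem hmem _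
    have h1 : ∫ s in a..r, ψ₀ s = (∫ s in a..r, deriv u s) - ∫ s in a..r, (H s + c) / s :=
      intervalIntegral.integral_sub (hac.mono hsubr).intervalIntegrable_deriv
        (hpi.mono_set hsubr)
    have h2 : (∫ s in R..a, (H s + c) / s) + ∫ s in a..r, (H s + c) / s
        = ∫ s in R..r, (H s + c) / s :=
      intervalIntegral.integral_add_adjacent_intervals hpi.symm (hpi.mono_set hsubr)
    rw [hsplit, hφ0 a ⟨ha0.le, le_rfl⟩, hψeq, h1, (hac.mono hsubr).integral_deriv_eq_sub, ← h2, hUa]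
    ring
  have hφa : φ a = 0 := hφ0 a ⟨ha0.le, le_rfl⟩
  have hφR : φ R = 0 := by rw [hφ1 R ⟨haR.le, le_rfl⟩, hu.2.1]; simp
  have hφac : AbsolutelyContinuousOnInterval φ 0 R :=
    hψint.intervalIntegrable.absolutelyContinuousOnInterval_intervalIntegral (by simp [hR.le])
  have hdφ : ∀ᵐ r ∂(volume.restrict (Ioo 0 R)), deriv φ r = ψ r :=
    ae_deriv_integral_eq hR.le hψint.intervalIntegrable ⟨le_rfl, hR.le⟩
  have hφc : ContinuousOn φ (Icc a R) := by
    have := hφac.continuousOn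
    rw [uIcc_of_le hR.le] at this
    exact this.mono (Icc_subset_Icc_left ha0.le)
  have hIoo : Ioo a R ⊆ Ioo 0 R := Ioo_subset_Ioo_left ha0.le
  have hψ₀sq : IntegrableOn (fun r => r * ψ₀ r ^ 2) (Ioo a R) := by
    have h1 : IntegrableOn (fun r => r * ((H r + c) / r) ^ 2) (Ioo a R) :=
      ((continuousOn_id.mul (hpc.pow 2)).integrableOn_Icc).mono_set Ioo_subset_Icc_self
    refine Integrable.mono' ((((relaxed.integrableOn_kinetic hu).mono_set hIoo).add h1).const_mul 2)
      ?_ ?_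
    · exact continuous_id.aestronglyMeasurable.mul
        (((aestronglyMeasurable_deriv u _).sub
          ((hpc.mono Ioo_subset_Icc_self).aestronglyMeasurable measurableSet_Ioo)).pow 2)
    · filter_upwards [ae_restrict_mem measurableSet_Ioo] with r hr
      have hr0 : 0 < r := ha0.trans hr.1
      rw [Real.norm_of_nonneg (by positivity), Pi.add_apply, ← mul_add, mul_left_comm]
      refine mul_le_mul_of_nonneg_left ?_ hr0.le
      simp only [hψ₀d]
      nlinarith [sq_nonneg (deriv u r + (H r + c) / r)]
  have hφadm : φ ∈ admissible m R := by
    refine ⟨hφac, by simp [hφ], hφR, ?_⟩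
    have h1 : IntegrableOn (fun r => (m : ℝ) ^ 2 / r * φ r ^ 2) (Ioo a R) :=
      (((continuousOn_const.div continuousOn_id hne).mul (hφc.pow 2)).integrableOn_Icc).mono_set
        Ioo_subset_Icc_self
    have h2 : IntegrableOn ((Ioo a R).indicator
        (fun r => r * ψ₀ r ^ 2 + (m : ℝ) ^ 2 / r * φ r ^ 2)) (Ioo 0 R) :=
      ((integrable_indicator_iff measurableSet_Ioo).2 (hψ₀sq.add h1)).integrableOn
    refine h2.congr ?_
    filter_upwards [hdφ, ae_restrict_mem measurableSet_Ioo] with r hr hrI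
    simp only [energyDensity, hr]
    by_cases hra : a < r
    · have hmem : r ∈ Ioo a R := ⟨hra, hrI.2⟩
      rw [indicator_of_mem hmem, hψ, indicator_of_mem hmem]
    · have hn : r ∉ Ioo a R := fun h => hra h.1
      rw [indicator_of_notMem hn, hψ, indicator_of_notMem hn, hφ0 r ⟨hrI.1.le, not_lt.1 hra⟩]
      simp
  -- the weak equation tested with `φ`
  have hweak : ∫ r in Ioo a R, (r * deriv u r * ψ₀ r + F r * φ r) = 0 := by
    rw [← h φ hφadm, energyForm, ← integral_indicator measurableSet_Ioo,
      ← integral_indicator measurableSet_Ioo]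
    refine integral_congr_ae ?_
    rw [EventuallyEq]
    rw [ae_restrict_iff' measurableSet_Ioo] at hdφ
    filter_upwards [hdφ] with r hr
    by_cases hrI : r ∈ Ioo 0 R
    · rw [indicator_of_mem hrI, hr hrI]
      by_cases hra : r ∈ Ioo a R
      · rw [indicator_of_mem hra, hψ, indicator_of_mem hra]
        simp only [hF]; ring
      · have : r ≤ a := by by_contra hlt; exact hra ⟨not_le.1 hlt, hrI.2⟩
        rw [indicator_of_notMem hra, hψ, indicator_of_notMem hra, hφ0 r ⟨hrI.1.le, this⟩]
        ring
    · rw [indicator_of_notMem hrI, indicator_of_notMem (fun h => hrI (hIoo h))]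
  -- integration by parts against the classical flux `H + c`
  have hpac : AbsolutelyContinuousOnInterval (fun s => H s + c) a R := by
    have hconst : AbsolutelyContinuousOnInterval (fun _ : ℝ => c) a R :=
      (LipschitzWith.const c).lipschitzOnWith.absolutelyContinuousOnInterval
    exact hHac.fun_add hconst
  have hparts : ∫ r in Ioo a R, (F r * φ r + (H r + c) * ψ₀ r) = 0 := by
    have h0 := hpac.integral_deriv_mul_eq_sub (hφac.mono (by
      rw [uIcc_of_le haR.le, uIcc_of_le hR.le]; exact Icc_subset_Icc_left ha0.le))
    rw [hφa, hφR, mul_zero, mul_zero, sub_zero, intervalIntegral.integral_of_le haR.le,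
      integral_Ioc_eq_integral_Ioo] at h0
    rw [← h0]
    refine integral_congr_ae ?_
    filter_upwards [ae_deriv_integral_eq haR.le hFi ⟨haR.le, le_rfl⟩,
      ae_restrict_of_ae_restrict_of_subset hIoo hdφ, ae_restrict_mem measurableSet_Ioo]
      with r h1 h2 hr
    rw [deriv_add_const, h2, hψ, indicator_of_mem hr, ← h1]
  have hFφ : IntegrableOn (fun r => F r * φ r) (Ioo a R) :=
    (hFc.mul hφc).integrableOn_Icc.mono_set Ioo_subset_Icc_self
  have hpψ : IntegrableOn (fun r => (H r + c) * ψ₀ r) (Ioo a R) := by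
    have h1 : IntegrableOn ψ₀ (Icc a R) := by
      rwa [integrableOn_Icc_iff_integrableOn_Ioo,
        ← intervalIntegrable_iff_integrableOn_Ioo_of_le haR.le]
    exact (h1.continuousOn_mul (hHc.add continuousOn_const) isCompact_Icc).mono_set
      Ioo_subset_Icc_self
  have hsq0 : ∫ r in Ioo a R, r * ψ₀ r ^ 2 = 0 := by
    have e : ∀ r ∈ Ioo a R, r * deriv u r * ψ₀ r + F r * φ r
        = r * ψ₀ r ^ 2 + (F r * φ r + (H r + c) * ψ₀ r) := by
      intro r hr
      have hr0 : r ≠ 0 := (ha0.trans hr.1).ne'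
      simp only [hψ₀d]
      field_simp
      ring
    have hadd := integral_add hψ₀sq (hFφ.add hpψ)
    simp only [Pi.add_apply] at hadd
    rw [setIntegral_congr_fun measurableSet_Ioo e, hadd, hparts, add_zero] at hweak
    exact hweak
  have hψ0 : ∀ᵐ r ∂(volume.restrict (Ioo a R)), ψ₀ r = 0 := by
    have := (integral_eq_zero_iff_of_nonneg_ae ?_ hψ₀sq).1 hsq0
    · filter_upwards [this, ae_restrict_mem measurableSet_Ioo] with r hr hrI
      have hr0 : r ≠ 0 := (ha0.trans hrI.1).ne'
      simpa [hr0] using hr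
    · filter_upwards [ae_restrict_mem measurableSet_Ioo] with r hr
      have := ha0.trans hr.1
      simp only [Pi.zero_apply]; positivity
  have hψall : ψ =ᵐ[volume] 0 := by
    rw [ae_restrict_iff' measurableSet_Ioo] at hψ0
    filter_upwards [hψ0] with r hr
    by_cases hrI : r ∈ Ioo a R
    · rw [hψ, indicator_of_mem hrI, hr hrI]; rfl
    · rw [hψ, indicator_of_notMem hrI]; rfl
  intro r hr
  have : φ r = 0 := by
    simp only [hφ]
    rw [intervalIntegral.integral_congr_ae (g := fun _ => 0)
      (by filter_upwards [hψall] with s hs _ using hs)]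
    simp
  linarith [hφ1 r hr]

/-! ### Classical regularity in the interior and at the outer end point -/

lemma hasDerivAt_integral_of_continuousOn {f : ℝ → ℝ} {a b c r : ℝ}
    (hf : ContinuousOn f (Icc a b)) (hc : c ∈ Icc a b) (hr : r ∈ Ioo a b) :
    HasDerivAt (fun x => ∫ s in c..x, f s) (f r) r := by
  have hsub : uIcc c r ⊆ Icc a b :=
    uIcc_subset_Icc hc (Ioo_subset_Icc_self hr)
  refine intervalIntegral.integral_hasDerivAt_right (hf.mono hsub).intervalIntegrable
    ((hf.mono Ioo_subset_Icc_self).stronglyMeasurableAtFilter isOpen_Ioo r hr)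
    (hf.continuousAt (Icc_mem_nhds hr.1 hr.2))

/-- A function satisfying the twice integrated equation is a classical solution in `(0, R)`, and its
derivative extends continuously to the outer end point. -/
lemma hasDerivAt_of_eq_integral (hR : 0 < R) {F : ℝ → ℝ} (hF : ContinuousOn F (Ioc 0 R))
    (h : ∀ a ∈ Ioo 0 R, ∃ c, ∀ r ∈ Icc a R, u r = ∫ s in R..r, ((∫ x in R..s, F x) + c) / s) :
    (∀ r ∈ Ioo 0 R, HasDerivAt u (deriv u r) r) ∧
    (∀ r ∈ Ioo 0 R, HasDerivAt (fun s => s * deriv u s) (F r) r) ∧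
    ∃ l, Tendsto (deriv u) (𝓝[<] R) (𝓝 l) := by
  have key : ∀ a ∈ Ioo 0 R, ∃ c, ContinuousOn (fun s => ((∫ x in R..s, F x) + c) / s) (Icc a R) ∧
      ∀ r ∈ Ioo a R, HasDerivAt (fun x => ∫ s in R..x, F s) (F r) r ∧
        HasDerivAt u (((∫ x in R..r, F x) + c) / r) r := by
    intro a ha
    obtain ⟨c, hc⟩ := h a ha
    have hRm : R ∈ Icc a R := ⟨ha.2.le, le_rfl⟩
    have hFc : ContinuousOn F (Icc a R) := hF.mono fun x hx => ⟨ha.1.trans_le hx.1, hx.2⟩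
    have hFi : IntervalIntegrable F volume a R := by
      apply ContinuousOn.intervalIntegrable; rwa [uIcc_of_le ha.2.le]
    have hH := (hFi.absolutelyContinuousOnInterval_intervalIntegral right_mem_uIcc).continuousOn
    rw [uIcc_of_le ha.2.le] at hH
    have hp : ContinuousOn (fun s => ((∫ x in R..s, F x) + c) / s) (Icc a R) :=
      (hH.add continuousOn_const).div continuousOn_id fun x hx => (ha.1.trans_le hx.1).ne'
    refine ⟨c, hp, fun r hr => ⟨hasDerivAt_integral_of_continuousOn hFc hRm hr, ?_⟩⟩
    refine (hasDerivAt_integral_of_continuousOn hp hRm hr).congr_of_eventuallyEq ?_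
    filter_upwards [Icc_mem_nhds hr.1 hr.2] with s hs using hc s hs
  refine ⟨fun r hr => ?_, fun r hr => ?_, ?_⟩
  · obtain ⟨c, -, hc⟩ := key (r / 2) ⟨by linarith [hr.1], by linarith [hr.1, hr.2]⟩
    exact (hc r ⟨by linarith [hr.1], hr.2⟩).2.differentiableAt.hasDerivAt
  · obtain ⟨c, -, hc⟩ := key (r / 2) ⟨by linarith [hr.1], by linarith [hr.1, hr.2]⟩
    have hrm : r ∈ Ioo (r / 2) R := ⟨by linarith [hr.1], hr.2⟩
    refine ((hc r hrm).1.add_const c).congr_of_eventuallyEq ?_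
    filter_upwards [Ioo_mem_nhds hrm.1 hrm.2] with s hs
    have hs0 : s ≠ 0 := by have := hs.1; have := hr.1; intro h0; linarith
    rw [(hc s hs).2.deriv]
    field_simp
  · obtain ⟨c, hcont, hc⟩ := key (R / 2) ⟨by linarith, by linarith⟩
    refine ⟨_, Tendsto.congr' ?_ (((hcont R ⟨by linarith, le_rfl⟩).mono Ioo_subset_Icc_self).mono_left
      (nhdsWithin_Ioo_eq_nhdsLT (show R / 2 < R by linarith)).ge)⟩
    filter_upwards [Ioo_mem_nhdsLT (show R / 2 < R by linarith)] with s hs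
    exact (hc s hs).2.deriv.symm

/-- A function on a closed interval is `C²` if it is twice differentiable inside and its second
derivative has limits at both end points. -/
lemma contDiffOn_two_Icc_of_tendsto {a b : ℝ} (hab : a < b) {u u₁ u₂ : ℝ → ℝ} {l₀ l₁ : ℝ}
    (hu : ContinuousOn u (Icc a b)) (h₁ : ∀ r ∈ Ioo a b, HasDerivAt u (u₁ r) r)
    (h₂ : ∀ r ∈ Ioo a b, HasDerivAt u₁ (u₂ r) r) (hc : ContinuousOn u₂ (Ioo a b))
    (ha : Tendsto u₂ (𝓝[>] a) (𝓝 l₀)) (hb : Tendsto u₂ (𝓝[<] b) (𝓝 l₁)) :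
    ContDiffOn ℝ 2 u (Icc a b) := by
  have hg := continuousOn_Icc_extendFrom_Ioo hc ha hb
  have hgeq : ∀ r ∈ Ioo a b, extendFrom (Ioo a b) u₂ r = u₂ r := fun r hr =>
    extendFrom_eq (subset_closure hr) ((hc r hr))
  set G : ℝ → ℝ := IccExtend hab.le ((Icc a b).domRestrict (extendFrom (Ioo a b) u₂)) with hG
  have hGc : Continuous G := (continuousOn_iff_continuous_domRestrict.1 hg).Icc_extend'
  have hGeq : ∀ r ∈ Ioo a b, G r = u₂ r := fun r hr => by
    rw [hG, IccExtend_of_mem _ _ (Ioo_subset_Icc_self hr)]; exact hgeq r hr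
  set c := (a + b) / 2
  have hcm : c ∈ Ioo a b := ⟨by simp only [c]; linarith, by simp only [c]; linarith⟩
  -- two functions with the same derivative and the same value at the midpoint coincide
  have huniq : ∀ f g f' : ℝ → ℝ, (∀ r ∈ Ioo a b, HasDerivAt f (f' r) r) →
      (∀ r ∈ Ioo a b, HasDerivAt g (f' r) r) → f c = g c → EqOn f g (Ioo a b) := by
    intro f g f' hf hg' h
    refine isOpen_Ioo.eqOn_of_deriv_eq isPreconnected_Ioo
      (fun r hr => (hf r hr).differentiableAt.differentiableWithinAt)
      (fun r hr => (hg' r hr).differentiableAt.differentiableWithinAt)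
      (fun r hr => by rw [(hf r hr).deriv, (hg' r hr).deriv]) hcm h
  set V : ℝ → ℝ := fun x => u₁ c + ∫ s in c..x, G s with hV
  have hVd : ∀ x, HasDerivAt V (G x) x := fun x =>
    (hGc.integral_hasStrictDerivAt c x).hasDerivAt.const_add _
  have hVc : Continuous V := continuous_iff_continuousAt.2 fun x => (hVd x).continuousAt
  have hV1 : EqOn u₁ V (Ioo a b) :=
    huniq _ _ u₂ h₂ (fun r hr => hGeq r hr ▸ hVd r) (by simp [hV])
  set U : ℝ → ℝ := fun x => u c + ∫ s in c..x, V s with hU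
  have hUd : ∀ x, HasDerivAt U (V x) x := fun x =>
    (hVc.integral_hasStrictDerivAt c x).hasDerivAt.const_add _
  have hUc : Continuous U := continuous_iff_continuousAt.2 fun x => (hUd x).continuousAt
  have hU1 : EqOn u U (Ioo a b) :=
    huniq _ _ u₁ h₁ (fun r hr => (hV1 hr).symm ▸ hUd r) (by simp [hU])
  have hU2 : EqOn u U (Icc a b) := by
    have := hU1.of_subset_closure hu hUc.continuousOn Ioo_subset_Icc_self
      (by rw [closure_Ioo hab.ne])
    exact this
  have hdU : deriv U = V := funext fun x => (hUd x).deriv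
  have hdV : deriv V = G := funext fun x => (hVd x).deriv
  have hU2c : ContDiff ℝ 2 U := by
    rw [show (2 : WithTop ℕ∞) = 1 + 1 by norm_num, contDiff_succ_iff_deriv]
    refine ⟨fun x => (hUd x).differentiableAt, by simp, ?_⟩
    rw [hdU, contDiff_one_iff_deriv, hdV]
    exact ⟨fun x => (hVd x).differentiableAt, hGc⟩
  exact hU2c.contDiffOn.congr hU2

/-! ### Regularity at the singular end point -/

/-- Finite kinetic energy forces `r u_r` to be small at points arbitrarily close to `0`, since
`1 / r` is not integrable there. -/
lemma frequently_abs_mul_deriv_le (hR : 0 < R)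
    (hu : IntegrableOn (fun r => r * deriv u r ^ 2) (Ioo 0 R)) {ε : ℝ} (hε : 0 < ε) :
    ∃ᶠ r in 𝓝[>] (0 : ℝ), |r * deriv u r| ≤ ε := by
  intro hcon
  obtain ⟨δ, hδ, hδs⟩ := mem_nhdsGT_iff_exists_Ioo_subset.1 hcon
  rw [mem_Ioi] at hδ
  have hδ' : 0 < min δ R := lt_min hδ hR
  have hint : IntegrableOn (fun r : ℝ => r⁻¹) (Ioo 0 (min δ R)) := by
    refine Integrable.mono' ((hu.mono_set (Ioo_subset_Ioo_right (min_le_right _ _))).const_mul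
      (ε ^ 2)⁻¹) measurable_inv.aestronglyMeasurable ?_
    filter_upwards [ae_restrict_mem measurableSet_Ioo] with r hr
    have hr0 := hr.1
    have h1 : ε < |r * deriv u r| :=
      not_le.1 (hδs ⟨hr.1, hr.2.trans_le (min_le_left _ _)⟩)
    have h2 : ε ^ 2 ≤ (r * deriv u r) ^ 2 := by
      rw [← sq_abs (r * deriv u r)]; gcongr
    rw [Real.norm_of_nonneg (by positivity), inv_mul_eq_div, le_div_iff₀ (by positivity),
      inv_mul_eq_div, div_le_iff₀ hr0]
    nlinarith
  have h3 : IntervalIntegrable (fun r : ℝ => r⁻¹) volume 0 (min δ R) := by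
    rwa [intervalIntegrable_iff_integrableOn_Ioo_of_le hδ'.le]
  rw [intervalIntegrable_inv_iff] at h3
  rcases h3 with h3 | h3
  · exact hδ'.ne h3
  · exact h3 left_mem_uIcc

/-- A solution of the singular linear equation that is not too large at `0` is `O(r ^ k)`, and
behaves like a multiple of `r ^ k` to first order. With `p = r u_r`, the quantity
`r ^ k (p - k u)` has derivative `r ^ (k + 1) q u`, and divided by `r ^ (2 k + 1)` it is the
derivative of `u / r ^ k`; every pass through these two relations gains one power of `r`. -/
lemma singular_endpoint_asymptotics {k : ℕ} (hk : 1 ≤ k) {b C M : ℝ} (hb : 0 < b)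
    {u p q : ℝ → ℝ} (hu : ∀ r ∈ Ioc 0 b, HasDerivAt u (p r / r) r)
    (hp : ∀ r ∈ Ioc 0 b, HasDerivAt p (((k : ℝ) ^ 2 / r + q r * r) * u r) r)
    (hC : ∀ r, |q r| ≤ C) (hM : ∀ r ∈ Ioc 0 b, √r * |u r| ≤ M)
    (hfreq : ∀ ε > 0, ∃ᶠ r in 𝓝[>] (0 : ℝ), |p r| ≤ ε) :
    ∃ K A, (∀ r ∈ Ioc 0 b, |u r| ≤ K * r ^ k) ∧
      (∀ r ∈ Ioc 0 b, |p r - k * u r| ≤ K * r ^ (k + 2)) ∧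
      Tendsto (fun r => u r / r ^ k) (𝓝[>] 0) (𝓝 A) := by
  have hC0 : 0 ≤ C := (abs_nonneg _).trans (hC 0)
  have hM0 : 0 ≤ M := (by positivity : 0 ≤ √b * |u b|).trans (hM b ⟨hb, le_rfl⟩)
  set G : ℝ → ℝ := fun r => r ^ k * (p r - k * u r) with hG
  have hGd : ∀ r ∈ Ioc 0 b, HasDerivAt G (r ^ (k + 1) * q r * u r) r := by
    intro r hr
    have hr0 : r ≠ 0 := hr.1.ne'
    refine ((hasDerivAt_pow k r).mul ((hp r hr).sub ((hu r hr).const_mul (k : ℝ)))).congr_deriv ?_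
    obtain ⟨n, rfl⟩ : ∃ n, k = n + 1 := ⟨k - 1, by omega⟩
    simp only [Nat.add_sub_cancel, Pi.sub_apply]
    push_cast
    field_simp
    ring
  -- `G` is small at points arbitrarily close to `0`
  have hGfreq : ∀ ε > 0, ∃ᶠ r in 𝓝[>] (0 : ℝ), |G r| ≤ ε := by
    intro ε hε
    have ht : Tendsto (fun r : ℝ => k * (√r * M)) (𝓝[>] 0) (𝓝 0) := by
      have : Tendsto (fun r : ℝ => k * (√r * M)) (𝓝 0) (𝓝 (k * (√0 * M))) := by
        apply Continuous.tendsto; fun_prop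
      simpa using this.mono_left nhdsWithin_le_nhds
    have hev : ∀ᶠ r in 𝓝[>] (0 : ℝ), k * (√r * M) < ε / 2 ∧ r < 1 ∧ r ∈ Ioc 0 b :=
      (ht.eventually_lt_const (by positivity)).and
        (Filter.Eventually.and (mem_nhdsWithin_of_mem_nhds (Iio_mem_nhds one_pos))
          (Ioc_mem_nhdsGT hb))
    refine ((hfreq (ε / 2) (by positivity)).and_eventually hev).mono ?_
    rintro r ⟨h1, h2, h3, h4⟩
    have hr0 := h4.1
    have hrk : r ^ k ≤ r := by simpa using pow_le_pow_of_le_one hr0.le h3.le hk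
    have hsq : √r * √r = r := Real.mul_self_sqrt hr0.le
    calc |G r| = r ^ k * |p r - k * u r| := by rw [hG, abs_mul, abs_of_pos (by positivity)]
      _ ≤ r ^ k * (|p r| + k * |u r|) := by
          gcongr
          refine (abs_sub _ _).trans_eq ?_
          rw [abs_mul, Nat.abs_cast]
      _ ≤ r ^ k * |p r| + k * (r * |u r|) := by
          rw [mul_add, mul_left_comm]
          gcongr
      _ ≤ 1 * |p r| + k * (√r * M) := by
          have : r * |u r| = √r * (√r * |u r|) := by rw [← mul_assoc, hsq]
          rw [this]
          gcongr
          · linarith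
          · exact hM r h4
      _ ≤ ε := by linarith
  -- gain in the first relation
  have stepG : ∀ (j : ℕ) (K : ℝ), 0 ≤ K → (∀ r ∈ Ioc 0 b, r * |u r| ≤ K * r ^ j) →
      ∀ r ∈ Ioc 0 b, |G r| ≤ C * K * r ^ (k + j + 1) := by
    intro j K hK hj r hr
    refine le_of_forall_pos_le_add fun ε hε => ?_
    obtain ⟨x, hx1, hx2⟩ := ((hGfreq ε hε).and_eventually (Ioo_mem_nhdsGT hr.1)).exists
    have hmv : ‖G r - G x‖ ≤ C * K * r ^ (k + j) * ‖r - x‖ := by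
      refine (convex_Icc x r).norm_image_sub_le_of_norm_hasDerivWithin_le
        (f' := fun s => s ^ (k + 1) * q s * u s)
        (fun s hs => (hGd s ⟨hx2.1.trans_le hs.1, hs.2.trans hr.2⟩).hasDerivWithinAt)
        (fun s hs => ?_) ⟨le_rfl, hx2.2.le⟩ ⟨hx2.2.le, le_rfl⟩
      have hs0 : 0 < s := hx2.1.trans_le hs.1
      have h1 := hj s ⟨hs0, hs.2.trans hr.2⟩
      rw [Real.norm_eq_abs, abs_mul, abs_mul, abs_of_pos (by positivity : 0 < s ^ (k + 1))]
      calc s ^ (k + 1) * |q s| * |u s| = s ^ k * |q s| * (s * |u s|) := by ring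
        _ ≤ s ^ k * C * (K * s ^ j) := by gcongr; exact hC s
        _ = C * K * s ^ (k + j) := by ring
        _ ≤ C * K * r ^ (k + j) := by gcongr; exact hs.2
    rw [Real.norm_eq_abs, Real.norm_eq_abs, abs_of_pos (sub_pos.2 hx2.2)] at hmv
    have h2 : C * K * r ^ (k + j) * (r - x) ≤ C * K * r ^ (k + j) * r := by
      have := hr.1
      gcongr
      linarith [hx2.1]
    have h3 : |G r| ≤ |G r - G x| + |G x| := by
      simpa using abs_add_le (G r - G x) (G x)
    calc |G r| ≤ C * K * r ^ (k + j) * r + ε := by linarith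
      _ = _ := by ring
  set W : ℝ → ℝ := fun r => u r / r ^ k with hW
  have hWd : ∀ r ∈ Ioc 0 b, HasDerivAt W (G r / r ^ (2 * k + 1)) r := by
    intro r hr
    have hr0 : r ≠ 0 := hr.1.ne'
    refine ((hu r hr).div (hasDerivAt_pow k r) (pow_ne_zero k hr0)).congr_deriv ?_
    obtain ⟨n, rfl⟩ : ∃ n, k = n + 1 := ⟨k - 1, by omega⟩
    simp only [Nat.add_sub_cancel, hG]
    push_cast
    field_simp
    ring
  -- gain in the second relation
  have stepU : ∀ j : ℕ, j ≤ k + 1 → ∃ K, 0 ≤ K ∧ ∀ r ∈ Ioc 0 b, r * |u r| ≤ K * r ^ j := by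
    intro j
    induction j with
    | zero =>
      intro _
      refine ⟨√b * M, by positivity, fun r hr => ?_⟩
      have hsq : √r * √r = r := Real.mul_self_sqrt hr.1.le
      calc r * |u r| = √r * (√r * |u r|) := by rw [← mul_assoc, hsq]
        _ ≤ √b * M := by gcongr; exacts [hr.2, hM r hr]
        _ = √b * M * r ^ 0 := by simp
    | succ j ih =>
      intro hj
      obtain ⟨K, hK, hKb⟩ := ih (by omega)
      have hGb := stepG j K hK hKb
      obtain ⟨n, rfl⟩ : ∃ n, k = j + n := ⟨k - j, by omega⟩
      refine ⟨|W b| * b ^ n + C * K * b, by positivity, fun r hr => ?_⟩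
      have hr0 := hr.1
      have hmv : ‖W b - W r‖ ≤ C * K / r ^ n * ‖b - r‖ := by
        refine (convex_Icc r b).norm_image_sub_le_of_norm_hasDerivWithin_le
          (f' := fun s => G s / s ^ (2 * (j + n) + 1))
          (fun s hs => (hWd s ⟨hr0.trans_le hs.1, hs.2⟩).hasDerivWithinAt)
          (fun s hs => ?_) ⟨le_rfl, hr.2⟩ ⟨hr.2, le_rfl⟩
        have hs0 : 0 < s := hr0.trans_le hs.1
        rw [Real.norm_eq_abs, abs_div, abs_of_pos (by positivity : 0 < s ^ (2 * (j + n) + 1))]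
        calc |G s| / s ^ (2 * (j + n) + 1)
            ≤ C * K * s ^ (j + n + j + 1) / s ^ (2 * (j + n) + 1) := by
              gcongr; exact hGb s ⟨hs0, hs.2⟩
          _ = C * K / s ^ n := by
              rw [div_eq_div_iff (by positivity) (by positivity)]; ring
          _ ≤ C * K / r ^ n := by gcongr; exact hs.1
      rw [Real.norm_eq_abs, Real.norm_eq_abs, abs_of_nonneg (sub_nonneg.2 hr.2)] at hmv
      have h1 : |W r| ≤ |W b| + C * K / r ^ n * b := by
        have h2 : |W r| ≤ |W b| + |W b - W r| := by
          have := abs_sub (W b) (W b - W r); simpa using this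
        have h3 : C * K / r ^ n * (b - r) ≤ C * K / r ^ n * b := by gcongr; linarith
        linarith
      have hur : u r = r ^ (j + n) * W r := by simp only [hW]; field_simp
      have hrb : r ^ n ≤ b ^ n := by gcongr; exact hr.2
      calc r * |u r| = r ^ (j + n + 1) * |W r| := by
            rw [hur, abs_mul, abs_of_pos (by positivity : 0 < r ^ (j + n))]; ring
        _ ≤ r ^ (j + n + 1) * (|W b| + C * K / r ^ n * b) := by gcongr
        _ = (|W b| * r ^ n + C * K * b) * r ^ (j + 1) := by field_simp; ring
        _ ≤ (|W b| * b ^ n + C * K * b) * r ^ (j + 1) := by gcongr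
  obtain ⟨K, hK, hKb⟩ := stepU (k + 1) le_rfl
  have hGb := stepG (k + 1) K hK hKb
  refine ⟨max K (C * K), ?_⟩
  have hlip : LipschitzOnWith (Real.toNNReal (C * K * b)) W (Ioc 0 b) := by
    refine (convex_Ioc 0 b).lipschitzOnWith_of_nnnorm_hasDerivWithin_le
      (f' := fun s => G s / s ^ (2 * k + 1)) (fun s hs => (hWd s hs).hasDerivWithinAt)
      (fun s hs => ?_)
    have hs0 := hs.1
    rw [← NNReal.coe_le_coe, coe_nnnorm, Real.coe_toNNReal _ (by positivity), Real.norm_eq_abs,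
      abs_div, abs_of_pos (by positivity : 0 < s ^ (2 * k + 1)), div_le_iff₀ (by positivity)]
    calc |G s| ≤ C * K * s ^ (k + (k + 1) + 1) := hGb s hs
      _ = C * K * s * s ^ (2 * k + 1) := by ring
      _ ≤ C * K * b * s ^ (2 * k + 1) := by gcongr; exact hs.2
  obtain ⟨g, hg, hgW⟩ := hlip.extend_real
  refine ⟨g 0, fun r hr => ?_, fun r hr => ?_, ?_⟩
  · have hr0 := hr.1
    have h1 : r * |u r| ≤ r * (K * r ^ k) := (hKb r hr).trans_eq (by ring)
    exact (le_of_mul_le_mul_left h1 hr0).trans (by gcongr; exact le_max_left _ _)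
  · have hr0 := hr.1
    have h1 : r ^ k * |p r - k * u r| ≤ r ^ k * (C * K * r ^ (k + 2)) := by
      have := hGb r hr
      simp only [hG, abs_mul, abs_of_pos (by positivity : 0 < r ^ k)] at this
      exact this.trans_eq (by ring)
    exact (le_of_mul_le_mul_left h1 (by positivity)).trans (by gcongr; exact le_max_right _ _)
  · refine (hg.continuous.continuousAt.tendsto.mono_left nhdsWithin_le_nhds).congr' ?_
    filter_upwards [Ioc_mem_nhdsGT hb] with r hr using (hgW hr).symm

/-! ### Weak solutions are classical solutions -/

lemma relaxed.continuousOn_potential (hα : 0 < α) (hu : u ∈ relaxed m R) (β : ℝ) :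
    ContinuousOn (fun r => saturation α u r + β) (Ioc 0 R) := by
  refine ContinuousOn.add (continuousOn_const.div ?_ fun r _ => ?_) continuousOn_const
  · exact continuousOn_const.add
      (continuousOn_const.mul ((relaxed.continuousOn_Ioc hu).pow 2))
  · positivity

lemma abs_potential_le (hα : 0 < α) (u : ℝ → ℝ) (β r : ℝ) :
    |saturation α u r + β| ≤ 1 + |β| :=
  (abs_add_le _ _).trans (by gcongr; exact abs_saturation_le hα u r)

lemma hasDerivAt_of_weak (hα : 0 < α) (hR : 0 < R) (hu : u ∈ relaxed m R)
    (h : ∀ v ∈ admissible m R, energyForm m R (fun r => saturation α u r + β) u v = 0) :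
    (∀ r ∈ Ioo 0 R, HasDerivAt u (deriv u r) r) ∧
    (∀ r ∈ Ioo 0 R, HasDerivAt (fun s => s * deriv u s)
      (((m : ℝ) ^ 2 / r + (saturation α u r + β) * r) * u r) r) ∧
    ∃ l, Tendsto (deriv u) (𝓝[<] R) (𝓝 l) := by
  have hq := relaxed.continuousOn_potential hα hu β
  refine hasDerivAt_of_eq_integral hR ?_ fun a ha =>
    exists_eq_integral_of_energyForm_eq_zero hu hq h ha
  exact ((continuousOn_const.div continuousOn_id fun r hr => hr.1.ne').add
    (hq.mul continuousOn_id)).mul (relaxed.continuousOn_Ioc hu)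

theorem contDiffOn_of_weak (hm : m ≠ 0) (hα : 0 < α) (hR : 0 < R) (hu : u ∈ relaxed m R)
    (hu0 : u 0 = 0)
    (h : ∀ v ∈ admissible m R, energyForm m R (fun r => saturation α u r + β) u v = 0) :
    ContDiffOn ℝ 2 u (Icc 0 R) := by
  obtain ⟨hd1, hd2, l, hl⟩ := hasDerivAt_of_weak hα hR hu h
  set q : ℝ → ℝ := fun r => saturation α u r + β with hq
  have hqc : ContinuousOn q (Ioc 0 R) := relaxed.continuousOn_potential hα hu β
  have huc := relaxed.continuousOn_Ioc hu
  set p : ℝ → ℝ := fun s => s * deriv u s with hp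
  set k := m.natAbs with hkdef
  have hk : 1 ≤ k := Int.natAbs_pos.2 hm
  have hkm : (m : ℝ) ^ 2 = (k : ℝ) ^ 2 := by
    rw [hkdef, Nat.cast_natAbs, Int.cast_abs, sq_abs]
  rw [hkm] at hd2
  have hIoc : ∀ r ∈ Ioc 0 (R / 2), r ∈ Ioo 0 R := fun r hr => ⟨hr.1, by linarith [hr.2]⟩
  obtain ⟨K, A, hK1, hK2, hA⟩ := singular_endpoint_asymptotics (p := p) (q := q) hk
    (half_pos hR) (u := u)
    (fun r hr => by
      have hr0 : r ≠ 0 := hr.1.ne'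
      exact (hd1 r (hIoc r hr)).congr_deriv (by simp only [hp]; field_simp))
    (fun r hr => hd2 r (hIoc r hr)) (abs_potential_le hα u β)
    (fun r hr => relaxed.sqrt_mul_abs_le hu (hIoc r hr))
    (fun ε hε => frequently_abs_mul_deriv_le hR (relaxed.integrableOn_kinetic hu) hε)
  have hnhds : ∀ᶠ r in 𝓝[>] (0 : ℝ), r ∈ Ioc 0 (R / 2) := Ioc_mem_nhdsGT (half_pos hR)
  have hpow : ∀ n : ℕ, 1 ≤ n → Tendsto (fun r : ℝ => K * r ^ n) (𝓝[>] 0) (𝓝 0) := fun n hn => by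
    have : Tendsto (fun r : ℝ => K * r ^ n) (𝓝 0) (𝓝 (K * 0 ^ n)) := by
      apply Continuous.tendsto; fun_prop
    rw [zero_pow (by omega), mul_zero] at this
    exact this.mono_left nhdsWithin_le_nhds
  have hu_lim : Tendsto u (𝓝[>] 0) (𝓝 0) :=
    squeeze_zero_norm' (hnhds.mono fun r hr => hK1 r hr) (hpow k hk)
  -- continuity on the closed interval
  have hcont : ContinuousOn u (Icc 0 R) := by
    intro r hr
    rcases hr.1.eq_or_lt with rfl | hr0
    · rw [ContinuousWithinAt, ← Ioc_insert_left hr.2, nhdsWithin_insert]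
      refine tendsto_sup.2 ⟨tendsto_pure_nhds u 0, ?_⟩
      rw [hu0]
      exact hu_lim.mono_left (nhdsWithin_mono _ Ioc_subset_Ioi_self)
    · refine (huc r ⟨hr0, hr.2⟩).mono_of_mem_nhdsWithin ?_
      filter_upwards [self_mem_nhdsWithin, mem_nhdsWithin_of_mem_nhds (Ioi_mem_nhds hr0)]
        with s hs hs2 using ⟨hs2, hs.2⟩
  set u₂ : ℝ → ℝ := fun r => ((k : ℝ) ^ 2 / r + q r * r) * u r / r - deriv u r / r with hu₂
  have hdd : ∀ r ∈ Ioo 0 R, HasDerivAt (deriv u) (u₂ r) r := by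
    intro r hr
    have hr0 : r ≠ 0 := hr.1.ne'
    refine (((hd2 r hr).div (hasDerivAt_id r) hr0).congr_deriv ?_).congr_of_eventuallyEq ?_
    · simp only [hu₂, id, hp, hq]; field_simp
    · filter_upwards [Ioi_mem_nhds hr.1] with s hs
      have hs0 : s ≠ 0 := (mem_Ioi.1 hs).ne'
      simp only [Pi.div_apply, id, hp]; field_simp
  have hne : ∀ r ∈ Ioc 0 R, r ≠ 0 := fun r hr => hr.1.ne'
  have hpot : ContinuousOn (fun r => ((k : ℝ) ^ 2 / r + q r * r) * u r / r) (Ioc 0 R) :=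
    (((continuousOn_const.div continuousOn_id hne).add (hqc.mul continuousOn_id)).mul huc).div
      continuousOn_id hne
  have hc₂ : ContinuousOn u₂ (Ioo 0 R) := by
    refine (hpot.mono Ioo_subset_Ioc_self).sub (ContinuousOn.div (fun r hr => ?_) continuousOn_id
      fun r hr => hr.1.ne')
    exact (hdd r hr).continuousAt.continuousWithinAt
  -- limit of the second derivative at `R`
  have hlim_R : Tendsto u₂ (𝓝[<] R)
      (𝓝 (((k : ℝ) ^ 2 / R + q R * R) * u R / R - l / R)) := by
    refine Tendsto.sub ?_ (hl.div (tendsto_id.mono_left nhdsWithin_le_nhds) hR.ne')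
    have := hpot R ⟨hR, le_rfl⟩
    refine Tendsto.mono_left this ?_
    rw [← nhdsWithin_Ioo_eq_nhdsLT hR]
    exact nhdsWithin_mono _ Ioo_subset_Ioc_self
  -- limit of the second derivative at `0`, from the decomposition
  -- `u_rr = - (r u_r - k u) / r ^ 2 + (k ^ 2 - k) r ^ (k - 2) (u / r ^ k) + q u`
  have hlim_0 : ∃ l₀, Tendsto u₂ (𝓝[>] 0) (𝓝 l₀) := by
    have t1 : Tendsto (fun r => (p r - k * u r) / r ^ 2) (𝓝[>] 0) (𝓝 0) := by
      refine squeeze_zero_norm' (hnhds.mono fun r hr => ?_) (hpow k hk)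
      have hr0 := hr.1
      rw [Real.norm_eq_abs, abs_div, abs_of_pos (by positivity : 0 < r ^ 2),
        div_le_iff₀ (by positivity)]
      exact (hK2 r hr).trans_eq (by ring)
    have t2 : Tendsto (fun r => q r * u r) (𝓝[>] 0) (𝓝 0) := by
      have : Tendsto (fun r => (1 + |β|) * |u r|) (𝓝[>] 0) (𝓝 0) := by
        simpa using (hu_lim.abs.const_mul (1 + |β|))
      refine squeeze_zero_norm (fun r => ?_) this
      rw [Real.norm_eq_abs, abs_mul]
      exact mul_le_mul_of_nonneg_right (abs_potential_le hα u β r) (abs_nonneg _)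
    have t3 : ∃ l₀, Tendsto (fun r => ((k : ℝ) ^ 2 - k) * u r / r ^ 2) (𝓝[>] 0) (𝓝 l₀) := by
      rcases hk.eq_or_lt with h1 | h2
      · refine ⟨0, ?_⟩
        rw [← h1]
        simp
      · obtain ⟨n, hn⟩ : ∃ n, k = n + 2 := ⟨k - 2, by omega⟩
        have hpn : Tendsto (fun r : ℝ => r ^ n) (𝓝[>] 0) (𝓝 (0 ^ n)) :=
          ((continuous_pow n).tendsto 0).mono_left nhdsWithin_le_nhds
        refine ⟨((k : ℝ) ^ 2 - k) * (0 ^ n * A), ((hpn.mul hA).const_mul _).congr' ?_⟩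
        filter_upwards [hnhds] with r hr
        have hr0 : r ≠ 0 := hr.1.ne'
        rw [hn]
        field_simp
        ring
    obtain ⟨l₀, t3⟩ := t3
    refine ⟨_, ((t1.neg.add t3).add t2).congr' ?_⟩
    filter_upwards [hnhds] with r hr
    have hr0 : r ≠ 0 := hr.1.ne'
    simp only [hu₂, hp]
    field_simp
    ring
  obtain ⟨l₀, hl₀⟩ := hlim_0
  exact contDiffOn_two_Icc_of_tendsto hR hcont hd1 hdd hc₂ hl₀ hlim_R

/-- A nonnegative solution with nonzero flux has no interior zero: such a zero would be a critical
point, and the linear equation satisfied by `(u, r u_r)` would force `u = 0`. -/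
theorem pos_of_weak (hα : 0 < α) (hR : 0 < R) (hu : u ∈ relaxed m R)
    (h : ∀ v ∈ admissible m R, energyForm m R (fun r => saturation α u r + β) u v = 0)
    (hnn : ∀ r ∈ Icc 0 R, 0 ≤ u r) (hP : flux R u ≠ 0) : ∀ r ∈ Ioo 0 R, 0 < u r := by
  obtain ⟨hd1, hd2, -⟩ := hasDerivAt_of_weak hα hR hu h
  by_contra! hcon
  obtain ⟨z, hz, hz'⟩ := hcon
  have huz : u z = 0 := le_antisymm hz' (hnn z (Ioo_subset_Icc_self hz))
  have hmin : IsLocalMin u z := by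
    filter_upwards [Icc_mem_nhds hz.1 hz.2] with s hs
    rw [huz]; exact hnn s hs
  have hdz := hmin.deriv_eq_zero
  have hzero : ∀ r ∈ Ioo 0 R, u r = 0 := by
    intro r hr
    set a := min z r / 2
    have hmp : 0 < min z r := lt_min hz.1 hr.1
    have ha : 0 < a := half_pos hmp
    have haz : a < z := (half_lt_self hmp).trans_le (min_le_left _ _)
    have har : a < r := (half_lt_self hmp).trans_le (min_le_right _ _)
    set v : ℝ → ℝ × ℝ → ℝ × ℝ := fun t y =>
      (y.2 / t, ((m : ℝ) ^ 2 / t + (saturation α u t + β) * t) * y.1) with hv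
    set L : ℝ := 1 / a + ((m : ℝ) ^ 2 / a + (1 + |β|) * R) with hL
    have hL0 : 0 ≤ L := by positivity
    have hlip : ∀ t ∈ Ioo a R, LipschitzOnWith L.toNNReal (v t) univ := by
      intro t ht
      have ht0 : 0 < t := ha.trans ht.1
      refine (LipschitzWith.of_dist_le_mul fun x y => ?_).lipschitzOnWith
      rw [Real.coe_toNNReal _ hL0, Prod.dist_eq]
      refine max_le ?_ ?_
      · simp only [hv, Real.dist_eq]
        rw [← sub_div, abs_div, abs_of_pos ht0, div_eq_mul_one_div, mul_comm]
        refine mul_le_mul ?_ ?_ (abs_nonneg _) hL0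
        · have h1 : 1 / t ≤ 1 / a := one_div_le_one_div_of_le ha ht.1.le
          have h2 : 0 ≤ (m : ℝ) ^ 2 / a + (1 + |β|) * R := by positivity
          linarith
        · rw [← Real.dist_eq, Prod.dist_eq]; exact le_max_right _ _
      · simp only [hv, Real.dist_eq]
        rw [← mul_sub, abs_mul]
        refine mul_le_mul ?_ ?_ (abs_nonneg _) hL0
        · have h1 : (m : ℝ) ^ 2 / t ≤ (m : ℝ) ^ 2 / a := by gcongr; exact ht.1.le
          have h2 : |(saturation α u t + β) * t| ≤ (1 + |β|) * R := by
            rw [abs_mul, abs_of_pos ht0]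
            gcongr
            · exact abs_potential_le hα u β t
            · exact ht.2.le
          have h3 : |(m : ℝ) ^ 2 / t| = (m : ℝ) ^ 2 / t := abs_of_nonneg (by positivity)
          have h4 : 0 ≤ 1 / a := by positivity
          refine (abs_add_le _ _).trans ?_
          rw [h3]; linarith
        · rw [← Real.dist_eq, Prod.dist_eq]; exact le_max_left _ _
    have heq := ODE_solution_unique_of_mem_Ioo (v := v) (s := fun _ => univ)
      (f := fun t => (u t, t * deriv u t)) (g := fun _ => (0, 0)) hlip ⟨haz, hz.2⟩
      (fun t ht => ⟨by
        have htI : t ∈ Ioo 0 R := ⟨ha.trans ht.1, ht.2⟩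
        have ht0 : t ≠ 0 := htI.1.ne'
        refine ((hd1 t htI).prodMk (hd2 t htI)).congr_deriv ?_
        simp only [hv, Prod.mk.injEq, and_true]
        field_simp, mem_univ _⟩)
      (fun t _ => ⟨by
        refine (hasDerivAt_const t ((0 : ℝ), (0 : ℝ))).congr_deriv ?_
        simp only [hv, mul_zero, zero_div]; rfl, mem_univ _⟩) (by simp [huz, hdz])
    exact congrArg Prod.fst (heq ⟨har, hr.2⟩)
  apply hP
  rw [flux, setIntegral_congr_fun (g := fun _ => (0 : ℝ)) measurableSet_Ioo
    (fun r hr => by simp [hzero r hr])]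
  simp

theorem isPositiveSolution_of_weak (hm : m ≠ 0) (hα : 0 < α) (hR : 0 < R)
    (hu : u ∈ admissible m R)
    (h : ∀ v ∈ admissible m R, energyForm m R (fun r => saturation α u r + β) u v = 0)
    (hnn : ∀ r ∈ Icc 0 R, 0 ≤ u r) (hP : flux R u ≠ 0) :
    IsPositiveSolution m α R β u := by
  have hu' := admissible_subset_relaxed m R hu
  refine ⟨contDiffOn_of_weak hm hα hR hu' hu.2.1 h, hu.2.1, hu.2.2.1,
    pos_of_weak hα hR hu' h hnn hP, fun r hr => ?_⟩
  rw [((hasDerivAt_of_weak hα hR hu' h).2.1 r hr).deriv, saturation]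
  ring

/-! ### Passing to the absolute value -/

lemma sq_deriv_abs_le {f : ℝ → ℝ} {r : ℝ} (hf : ContinuousAt f r) :
    deriv (fun s => |f s|) r ^ 2 ≤ deriv f r ^ 2 := by
  rcases lt_trichotomy (f r) 0 with h | h | h
  · have : (fun s => |f s|) =ᶠ[𝓝 r] fun s => -f s := by
      filter_upwards [hf.eventually_lt_const h] with s hs using abs_of_neg hs
    rw [this.deriv_eq, deriv.fun_neg, neg_sq]
  · have : IsLocalMin (fun s => |f s|) r := Eventually.of_forall fun s => by simp [h]
    rw [this.deriv_eq_zero, zero_pow two_ne_zero]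
    exact sq_nonneg _
  · have : (fun s => |f s|) =ᶠ[𝓝 r] f := by
      filter_upwards [hf.eventually_const_lt h] with s hs using abs_of_pos hs
    rw [this.deriv_eq]

lemma flux_abs (R : ℝ) (u : ℝ → ℝ) : flux R (fun r => |u r|) = flux R u := by
  simp only [flux, sq_abs]

/-- For `u` of class `C²` the absolute value is Lipschitz, and its energy density is no larger. -/
lemma abs_mem_admissible (hu : u ∈ admissible m R) (hR : 0 < R)
    (hc : ContDiffOn ℝ 2 u (Icc 0 R)) : (fun r => |u r|) ∈ admissible m R := by
  have hu' := admissible_subset_relaxed m R hu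
  refine ⟨?_, by simp [hu.2.1], by simp [hu.2.2.1], ?_⟩
  · obtain ⟨K, hK⟩ := (hc.of_le one_le_two).exists_lipschitzOnWith one_ne_zero
      (convex_Icc _ _) isCompact_Icc
    have := (lipschitzWith_one_norm (E := ℝ)).comp_lipschitzOnWith hK
    rw [← uIcc_of_le hR.le] at this
    exact this.absolutelyContinuousOnInterval
  · refine Integrable.mono' hu.2.2.2 ?_ ?_
    · have h1 := (relaxed.aestronglyMeasurable hu').norm
      exact (continuous_id.aestronglyMeasurable.mul ((aestronglyMeasurable_deriv _ _).pow 2)).add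
        ((measurable_const.div measurable_id).aestronglyMeasurable.mul (h1.pow 2))
    · filter_upwards [ae_restrict_mem measurableSet_Ioo] with r hr
      have hr0 := hr.1
      have := sq_deriv_abs_le ((relaxed.continuousOn hu').continuousAt (Ioo_mem_nhds hr.1 hr.2))
      rw [energyDensity, energyDensity, Real.norm_of_nonneg (by positivity), sq_abs]
      gcongr

lemma action_abs_le (hm : m ≠ 0) (hα : 0 < α) (hu : u ∈ relaxed m R)
    (hu' : (fun r => |u r|) ∈ relaxed m R) :
    action m α R (fun r => |u r|) ≤ action m α R u := by
  refine mul_le_mul_of_nonneg_left ?_ (by norm_num)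
  refine setIntegral_mono_on (relaxed.integrableOn_action hm hα hu')
    (relaxed.integrableOn_action hm hα hu) measurableSet_Ioo fun r hr => ?_
  have hr0 := hr.1
  have := sq_deriv_abs_le ((relaxed.continuousOn hu).continuousAt (Ioo_mem_nhds hr.1 hr.2))
  simp only [sq_abs]
  gcongr

/-- The Euler–Lagrange identity for a minimizer over the admissible class. -/
lemma IsMinimizer.energyForm_eq_zero (hm : m ≠ 0) (hα : 0 < α) (hP₀ : 0 < P₀)
    (hu : IsMinimizer m α R P₀ u) :
    ∀ v ∈ admissible m R,
      energyForm m R (fun r => saturation α u r + propagationConstant m α R u) u v = 0 := by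
  intro v hv
  have hadm := hu.1.1
  refine energyForm_eq_zero_of_isMin hm hα hP₀ (admissible_subset_relaxed m R hadm)
    (admissible_subset_relaxed m R hv) hu.1.2 fun c t hct => ?_
  exact hu.2 ⟨admissible.smul_mem (admissible.add_smul_mem hadm hv t) c, hct⟩

theorem IsMinimizer.isPositiveSolution (hm : m ≠ 0) (hα : 0 < α) (hR : 0 < R) (hP₀ : 0 < P₀)
    (hu : IsMinimizer m α R P₀ u) (hnn : ∀ r ∈ Icc 0 R, 0 ≤ u r) :
    IsPositiveSolution m α R (propagationConstant m α R u) u ∧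
      IsLagrangeMultiplier m α R u (-propagationConstant m α R u / (4 * Real.pi)) := by
  have h := hu.energyForm_eq_zero hm hα hP₀
  have hP : flux R u ≠ 0 := by rw [hu.1.2]; exact hP₀.ne'
  exact ⟨isPositiveSolution_of_weak hm hα hR hu.1.1 h hnn hP,
    isLagrangeMultiplier_of_energyForm_eq_zero hm hα (admissible_subset_relaxed m R hu.1.1) h⟩

/-- A minimizer over the relaxed class is `C²` on `[0, R]`, hence admissible, and its absolute value
is a nonnegative minimizer over the admissible class. -/
theorem exists_nonneg_isMinimizer_of_relaxed (hm : m ≠ 0) (hα : 0 < α) (hR : 0 < R) (hP₀ : 0 < P₀)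
    (hu : u ∈ relaxed m R) (hu0 : u 0 = 0) (hP : flux R u = P₀)
    (hmin : ∀ w ∈ relaxed m R, flux R w = P₀ → action m α R u ≤ action m α R w) :
    ∃ w, IsMinimizer m α R P₀ w ∧ ∀ r, 0 ≤ w r := by
  have hw : ∀ v ∈ admissible m R,
      energyForm m R (fun r => saturation α u r + propagationConstant m α R u) u v = 0 :=
    fun v hv => energyForm_eq_zero_of_isMin hm hα hP₀ hu (admissible_subset_relaxed m R hv) hP
      fun c t hct => hmin _ (relaxed.smul_mem
        (relaxed.add_smul_mem hu (admissible_subset_relaxed m R hv) t) c) hct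
  have hC2 := contDiffOn_of_weak hm hα hR hu hu0 hw
  have hadm : u ∈ admissible m R := by
    refine ⟨ContDiffOn.absolutelyContinuousOnInterval ?_, hu0, hu.2.1, hu.2.2⟩
    rw [uIcc_of_le hR.le]
    exact hC2.of_le one_le_two
  have habs := abs_mem_admissible hadm hR hC2
  refine ⟨fun r => |u r|, ⟨⟨habs, by rw [flux_abs, hP]⟩, fun w hw => ?_⟩, fun r => abs_nonneg _⟩
  exact (action_abs_le hm hα hu (admissible_subset_relaxed m R habs)).trans
    (hmin w (admissible_subset_relaxed m R hw.1) hw.2)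

/-! ### Weak compactness and existence of a minimizer -/

/-- Bounded sequences in a separable Hilbert space have weakly convergent subsequences. -/
lemma exists_weakly_convergent_subseq {E : Type*} [NormedAddCommGroup E] [InnerProductSpace ℝ E]
    [CompleteSpace E] [TopologicalSpace.SeparableSpace E] {x : ℕ → E} {C : ℝ}
    (hx : ∀ n, ‖x n‖ ≤ C) :
    ∃ (y : E) (φ : ℕ → ℕ), StrictMono φ ∧
      ∀ z, Tendsto (fun n => inner ℝ (x (φ n)) z) atTop (𝓝 (inner ℝ y z)) := by
  obtain ⟨L, -, φ, hφ, hL⟩ := WeakDual.isSeqCompact_closedBall ℝ E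
    (0 : StrongDual ℝ E) C (x := fun n => StrongDual.toWeakDual (InnerProductSpace.toDual ℝ E (x n)))
    (fun n => by simpa using hx n)
  refine ⟨(InnerProductSpace.toDual ℝ E).symm (WeakDual.toStrongDual L), φ, hφ, fun z => ?_⟩
  have h := ((WeakDual.eval_continuous z).tendsto L).comp hL
  rw [InnerProductSpace.toDual_symm_apply]
  exact h

lemma absolutelyContinuousOnInterval_congr {f g : ℝ → ℝ} {a b : ℝ}
    (hf : AbsolutelyContinuousOnInterval f a b) (h : EqOn g f (uIcc a b)) :
    AbsolutelyContinuousOnInterval g a b := by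
  rw [absolutelyContinuousOnInterval_iff] at hf ⊢
  intro ε hε
  obtain ⟨δ, hδ, H⟩ := hf ε hε
  refine ⟨δ, hδ, fun E hE hE' => ?_⟩
  rw [Finset.sum_congr rfl fun i hi => ?_]
  · exact H E hE hE'
  · rw [h (hE.1 i hi).1, h (hE.1 i hi).2]

noncomputable section

/-- The function vanishing at `R` with derivative `f / √r`. The value at `0`, where the integral
may diverge, is set to `0`. -/
def primitive (R : ℝ) (f : ℝ → ℝ) (r : ℝ) : ℝ :=
  if r = 0 then 0 else ∫ s in R..r, f s / √s

/-- The kernel representing evaluation at `r` on primitives. -/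
def evalKernel (R r : ℝ) : ℝ → ℝ := (Ioo r R).indicator fun s => 1 / √s

end

lemma memLp_evalKernel {r : ℝ} (hr : 0 < r) :
    MemLp (evalKernel R r) 2 (volume.restrict (Ioo 0 R)) := by
  refine MemLp.of_bound ?_ (1 / √r) (Eventually.of_forall fun s => ?_)
  · exact ((Real.continuous_sqrt.measurable.const_div 1).indicator
      measurableSet_Ioo).aestronglyMeasurable
  · rw [evalKernel]
    by_cases hs : s ∈ Ioo r R
    · rw [indicator_of_mem hs, Real.norm_of_nonneg (by positivity)]
      have := Real.sqrt_pos.2 hr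
      gcongr
      exact hs.1.le
    · rw [indicator_of_notMem hs, norm_zero]
      positivity

lemma integral_mul_evalKernel (f : ℝ → ℝ) {r : ℝ} (hr : 0 < r) :
    ∫ s in Ioo 0 R, f s * evalKernel R r s = ∫ s in Ioo r R, f s / √s := by
  have : ∀ s, f s * evalKernel R r s = (Ioo r R).indicator (fun s => f s / √s) s := by
    intro s
    by_cases hs : s ∈ Ioo r R
    · rw [evalKernel, indicator_of_mem hs, indicator_of_mem hs, mul_one_div]
    · rw [evalKernel, indicator_of_notMem hs, indicator_of_notMem hs, mul_zero]
  simp_rw [this]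
  rw [setIntegral_indicator measurableSet_Ioo, inter_eq_right.2 (Ioo_subset_Ioo_left hr.le)]

lemma integrableOn_div_sqrt {f : ℝ → ℝ} (hf : MemLp f 2 (volume.restrict (Ioo 0 R))) {r : ℝ}
    (hr : 0 < r) : IntegrableOn (fun s => f s / √s) (Ioo r R) := by
  have h := (hf.integrable_mul (memLp_evalKernel (R := R) hr)).mono_measure
    (Measure.restrict_mono (Ioo_subset_Ioo_left (b := R) hr.le) le_rfl)
  refine h.congr ?_
  filter_upwards [ae_restrict_mem measurableSet_Ioo] with s hs
  simp only [Pi.mul_apply, evalKernel, indicator_of_mem hs, mul_one_div]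

lemma primitive_eq {r : ℝ} (f : ℝ → ℝ) (hr : r ∈ Ioo 0 R) :
    primitive R f r = -∫ s in Ioo r R, f s / √s := by
  rw [primitive, if_neg hr.1.ne', intervalIntegral.integral_symm,
    intervalIntegral.integral_of_le hr.2.le, integral_Ioc_eq_integral_Ioo]

lemma absolutelyContinuousOnInterval_primitive {f : ℝ → ℝ}
    (hf : MemLp f 2 (volume.restrict (Ioo 0 R))) {a : ℝ} (ha : a ∈ Ioo 0 R) :
    AbsolutelyContinuousOnInterval (primitive R f) a R := by
  have h : IntervalIntegrable (fun s => f s / √s) volume a R := by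
    rw [intervalIntegrable_iff_integrableOn_Ioo_of_le ha.2.le]
    exact integrableOn_div_sqrt hf ha.1
  refine absolutelyContinuousOnInterval_congr
    (h.absolutelyContinuousOnInterval_intervalIntegral right_mem_uIcc) fun r hr => ?_
  rw [uIcc_of_le ha.2.le] at hr
  rw [primitive, if_neg (ha.1.trans_le hr.1).ne']

lemma ae_deriv_primitive {f : ℝ → ℝ} (hf : MemLp f 2 (volume.restrict (Ioo 0 R))) :
    ∀ᵐ r ∂(volume.restrict (Ioo 0 R)), deriv (primitive R f) r = f r / √r := by
  refine ae_restrict_Ioo_of_forall fun a ha => ?_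
  have h : IntervalIntegrable (fun s => f s / √s) volume a R := by
    rw [intervalIntegrable_iff_integrableOn_Ioo_of_le ha.2.le]
    exact integrableOn_div_sqrt hf ha.1
  filter_upwards [ae_deriv_integral_eq ha.2.le h ⟨ha.2.le, le_rfl⟩,
    ae_restrict_mem measurableSet_Ioo] with r hr hra
  rw [← hr]
  refine Filter.EventuallyEq.deriv_eq ?_
  filter_upwards [Ioi_mem_nhds (ha.1.trans hra.1)] with s hs
  rw [primitive, if_neg (mem_Ioi.1 hs).ne']

lemma ae_kinetic_primitive {f : ℝ → ℝ} (hf : MemLp f 2 (volume.restrict (Ioo 0 R))) :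
    ∀ᵐ r ∂(volume.restrict (Ioo 0 R)), r * deriv (primitive R f) r ^ 2 = f r ^ 2 := by
  filter_upwards [ae_deriv_primitive hf, ae_restrict_mem measurableSet_Ioo] with r hr hrI
  have hr0 := hrI.1
  rw [hr, div_pow, Real.sq_sqrt hr0.le]
  field_simp

/-- Up to sign `√r u_r` is the square root of the kinetic energy density, so finite energy places it in
`L²(0, R)`. -/
lemma relaxed.memLp_sqrt_mul_deriv (hu : u ∈ relaxed m R) :
    MemLp (fun r => √r * deriv u r) 2 (volume.restrict (Ioo 0 R)) := by
  have hmeas : AEStronglyMeasurable (fun r => √r * deriv u r) (volume.restrict (Ioo 0 R)) :=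
    Real.continuous_sqrt.aestronglyMeasurable.mul (aestronglyMeasurable_deriv u _)
  rw [memLp_two_iff_integrable_sq hmeas]
  refine (relaxed.integrableOn_kinetic hu).congr ?_
  filter_upwards [ae_restrict_mem measurableSet_Ioo] with r hr
  rw [mul_pow, Real.sq_sqrt hr.1.le]

lemma relaxed.eq_neg_integral (hu : u ∈ relaxed m R) {r : ℝ} (hr : r ∈ Ioo 0 R) :
    u r = -∫ s in Ioo r R, (√s * deriv u s) / √s := by
  have h1 := (hu.1 r hr).integral_deriv_eq_sub
  rw [intervalIntegral.integral_of_le hr.2.le, integral_Ioc_eq_integral_Ioo, hu.2.1] at h1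
  have h2 : ∀ s ∈ Ioo r R, (√s * deriv u s) / √s = deriv u s := fun s hs =>
    mul_div_cancel_left₀ _ (Real.sqrt_pos.2 (hr.1.trans hs.1)).ne'
  rw [setIntegral_congr_fun measurableSet_Ioo h2, h1]
  ring

lemma inner_toLp_eq_integral {μ : Measure ℝ} {f g : ℝ → ℝ} (hf : MemLp f 2 μ) (hg : MemLp g 2 μ) :
    inner ℝ (hf.toLp f) (hg.toLp g) = ∫ s, f s * g s ∂μ := by
  rw [L2.inner_def]
  refine integral_congr_ae ?_
  filter_upwards [hf.coeFn_toLp, hg.coeFn_toLp] with s h1 h2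
  rw [h1, h2]
  simp [mul_comm]

/-- The parabola `r (R - r)`, rescaled, is feasible. -/
lemma exists_mem_relaxed_flux_eq (m : ℤ) (hR : 0 < R) (hP₀ : 0 < P₀) :
    ∃ w ∈ relaxed m R, flux R w = P₀ := by
  set w : ℝ → ℝ := fun r => r * (R - r) with hw
  have hd : ∀ r, HasDerivAt w (R - 2 * r) r := fun r =>
    ((hasDerivAt_id r).mul ((hasDerivAt_id r).const_sub R)).congr_deriv (by simp; ring)
  have hmem : w ∈ relaxed m R := by
    refine ⟨fun a _ => ContDiffOn.absolutelyContinuousOnInterval ?_, by simp [hw], ?_⟩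
    · exact ContDiff.contDiffOn (contDiff_id.mul (contDiff_const.sub contDiff_id))
    · have hc : Continuous fun r : ℝ =>
          r * (R - 2 * r) ^ 2 + (m : ℝ) ^ 2 * (r * (R - r) ^ 2) := by fun_prop
      have h1 : IntegrableOn (fun r : ℝ =>
          r * (R - 2 * r) ^ 2 + (m : ℝ) ^ 2 * (r * (R - r) ^ 2)) (Icc 0 R) :=
        hc.continuousOn.integrableOn_Icc
      refine (h1.mono_set Ioo_subset_Icc_self).congr ?_
      filter_upwards [ae_restrict_mem measurableSet_Ioo] with r hr
      have hr0 := hr.1.ne'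
      rw [energyDensity, (hd r).deriv]
      simp only [hw]
      field_simp
  have hpos : 0 < massForm R w w := by
    have hc : Continuous fun r => r * (w r * w r) := by fun_prop
    rw [massForm, ← integral_Ioc_eq_integral_Ioo, ← intervalIntegral.integral_of_le hR.le]
    refine intervalIntegral.intervalIntegral_pos_of_pos_on (hc.intervalIntegrable _ _)
      (fun r hr => ?_) hR
    have h1 := hr.1
    have h2 : 0 < R - r := sub_pos.2 hr.2
    positivity
  refine ⟨√(P₀ / (2 * Real.pi * massForm R w w)) • w, relaxed.smul_mem hmem _, ?_⟩
  have hpi := Real.pi_pos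
  rw [flux_eq_massForm, massForm_smul, Real.sq_sqrt (by positivity)]
  field_simp

/-- **Existence of a minimizer in the relaxed class**, by the direct method. -/
theorem exists_relaxed_minimizer (hm : m ≠ 0) (hα : 0 < α) (hR : 0 < R) (hP₀ : 0 < P₀) :
    ∃ u ∈ relaxed m R, u 0 = 0 ∧ flux R u = P₀ ∧
      ∀ w ∈ relaxed m R, flux R w = P₀ → action m α R u ≤ action m α R w := by
  set μ : Measure ℝ := volume.restrict (Ioo 0 R) with hμ
  set S : Set ℝ := action m α R '' {w | w ∈ relaxed m R ∧ flux R w = P₀} with hS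
  have hlog_nonneg : ∀ (w : ℝ → ℝ), ∀ r ∈ Ioo 0 R,
      0 ≤ r / α * Real.log (1 + α * w r ^ 2) := fun w r hr =>
    mul_nonneg (div_nonneg hr.1.le hα.le) (log_one_add_mul_sq_nonneg hα _)
  have hsplit : ∀ w ∈ relaxed m R, 2 * action m α R w
      = (∫ r in Ioo 0 R, r * deriv w r ^ 2) + (∫ r in Ioo 0 R, (m : ℝ) ^ 2 / r * w r ^ 2)
        + ∫ r in Ioo 0 R, r / α * Real.log (1 + α * w r ^ 2) := by
    intro w hw
    have h1 := relaxed.integrableOn_kinetic hw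
    have h2 := relaxed.integrableOn_centrifugal hw
    have h3 := relaxed.integrableOn_log hm hα hw
    rw [← integral_add h1 h2, ← integral_add (by exact h1.add h2) h3, action]
    ring
  have hkin_le : ∀ w ∈ relaxed m R, (∫ r in Ioo 0 R, r * deriv w r ^ 2) ≤ 2 * action m α R w := by
    intro w hw
    have h2 : 0 ≤ ∫ r in Ioo 0 R, (m : ℝ) ^ 2 / r * w r ^ 2 :=
      setIntegral_nonneg measurableSet_Ioo fun r hr =>
        mul_nonneg (div_nonneg (sq_nonneg _) hr.1.le) (sq_nonneg _)
    have h3 : 0 ≤ ∫ r in Ioo 0 R, r / α * Real.log (1 + α * w r ^ 2) :=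
      setIntegral_nonneg measurableSet_Ioo (hlog_nonneg w)
    rw [hsplit w hw]; linarith
  have hkin_nonneg : ∀ w : ℝ → ℝ, 0 ≤ ∫ r in Ioo 0 R, r * deriv w r ^ 2 := fun w =>
    setIntegral_nonneg measurableSet_Ioo fun r hr => mul_nonneg hr.1.le (sq_nonneg _)
  have hSne : S.Nonempty := by
    obtain ⟨w, h1, h2⟩ := exists_mem_relaxed_flux_eq (P₀ := P₀) m hR hP₀
    exact ⟨_, w, ⟨h1, h2⟩, rfl⟩
  have hSbdd : BddBelow S := by
    refine ⟨0, ?_⟩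
    rintro _ ⟨w, hw, rfl⟩
    linarith [hkin_le w hw.1, hkin_nonneg w]
  obtain ⟨s, hs_anti, hs_lim, hs_mem⟩ := exists_seq_tendsto_sInf hSne hSbdd
  choose w hw hws using hs_mem
  have hwr : ∀ n, w n ∈ relaxed m R := fun n => (hw n).1
  set B := 2 * s 0 with hB
  have hkinB : ∀ n, (∫ r in Ioo 0 R, r * deriv (w n) r ^ 2) ≤ B := fun n => by
    have h1 := hkin_le _ (hwr n)
    rw [hws n] at h1
    have h2 := hs_anti (Nat.zero_le n)
    linarith
  -- a weakly convergent subsequence of `√r w_r`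
  set F : ℕ → Lp ℝ 2 μ := fun n => (relaxed.memLp_sqrt_mul_deriv (hwr n)).toLp _ with hF
  have hFsq : ∀ n, ‖F n‖ ^ 2 = ∫ r in Ioo 0 R, r * deriv (w n) r ^ 2 := by
    intro n
    rw [← real_inner_self_eq_norm_sq, hF, inner_toLp_eq_integral]
    refine setIntegral_congr_fun measurableSet_Ioo fun r hr => ?_
    have := Real.mul_self_sqrt hr.1.le
    linear_combination (deriv (w n) r) ^ 2 * this
  have hFb : ∀ n, ‖F n‖ ≤ √B := fun n => Real.le_sqrt_of_sq_le (by rw [hFsq]; exact hkinB n)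
  have : Fact ((2 : ENNReal) ≠ ⊤) := ⟨ENNReal.ofNat_ne_top⟩
  obtain ⟨f, φ, hφ, hweak⟩ := exists_weakly_convergent_subseq hFb
  have hf : MemLp f 2 μ := Lp.memLp f
  have hf_toLp : hf.toLp f = f := Lp.toLp_coeFn f hf
  set u : ℝ → ℝ := primitive R f with hu
  -- pointwise convergence
  have hpt : ∀ r ∈ Ioo 0 R, Tendsto (fun n => w (φ n) r) atTop (𝓝 (u r)) := by
    intro r hr
    have h1 := (hweak ((memLp_evalKernel (R := R) hr.1).toLp _)).neg
    rw [← hf_toLp] at h1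
    simp only [hF, inner_toLp_eq_integral, hμ, integral_mul_evalKernel _ hr.1] at h1
    rw [← primitive_eq _ hr] at h1
    exact h1.congr fun n => (relaxed.eq_neg_integral (hwr (φ n)) hr).symm
  set D := (B + R) / 2 with hD
  have hbound : ∀ n, ∀ r ∈ Ioo 0 R, r * w n r ^ 2 ≤ D ^ 2 := by
    intro n r hr
    have h1 := relaxed.sqrt_mul_abs_le (hwr n) hr
    have h2 : √r * |w n r| ≤ D := h1.trans (by rw [hD]; linarith [hkinB n])
    have h3 : (√r * |w n r|) ^ 2 ≤ D ^ 2 := by gcongr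
    rwa [mul_pow, Real.sq_sqrt hr.1.le, sq_abs] at h3
  have hconst : ∀ (c : ℝ) (t : Set ℝ), t ⊆ Ioo 0 R →
      Integrable (fun _ : ℝ => c) (volume.restrict t) := fun c t ht => by
    refine (integrable_const c (μ := volume.restrict (Ioo 0 R))).mono_measure ?_
    exact Measure.restrict_mono ht le_rfl
  -- the flux constraint passes to the limit
  have hflux_lim : Tendsto (fun n => flux R (w (φ n))) atTop (𝓝 (flux R u)) := by
    refine Tendsto.const_mul _ (tendsto_integral_of_dominated_convergence (fun _ => D ^ 2)
      (fun n => (relaxed.integrableOn_mass hm (hwr (φ n))).aestronglyMeasurable)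
      (hconst _ _ Subset.rfl) (fun n => ?_) ?_)
    · filter_upwards [ae_restrict_mem measurableSet_Ioo] with r hr
      rw [Real.norm_of_nonneg (mul_nonneg hr.1.le (sq_nonneg _))]
      exact hbound _ r hr
    · filter_upwards [ae_restrict_mem measurableSet_Ioo] with r hr
      exact ((hpt r hr).pow 2).const_mul r
  have hflux : flux R u = P₀ :=
    tendsto_nhds_unique hflux_lim (tendsto_const_nhds.congr fun n => (hw (φ n)).2.symm)
  have hlog_lim : Tendsto (fun n => ∫ r in Ioo 0 R, r / α * Real.log (1 + α * w (φ n) r ^ 2)) atTop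
      (𝓝 (∫ r in Ioo 0 R, r / α * Real.log (1 + α * u r ^ 2))) := by
    refine tendsto_integral_of_dominated_convergence (fun _ => D ^ 2)
      (fun n => (relaxed.integrableOn_log hm hα (hwr (φ n))).aestronglyMeasurable)
      (hconst _ _ Subset.rfl) (fun n => ?_) ?_
    · filter_upwards [ae_restrict_mem measurableSet_Ioo] with r hr
      rw [Real.norm_of_nonneg (hlog_nonneg _ r hr)]
      refine le_trans ?_ (hbound (φ n) r hr)
      have h1 := log_one_add_mul_sq_le hα (w (φ n) r)
      rw [div_mul_eq_mul_div, div_le_iff₀ hα]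
      nlinarith [hr.1]
    · filter_upwards [ae_restrict_mem measurableSet_Ioo] with r hr
      have h1 : 1 + α * u r ^ 2 ≠ 0 := by positivity
      exact ((((hpt r hr).pow 2).const_mul α).const_add 1 |>.log h1).const_mul _
  have hcen_lim : ∀ ε ∈ Ioo 0 R,
      Tendsto (fun n => ∫ r in Ioo ε R, (m : ℝ) ^ 2 / r * w (φ n) r ^ 2) atTop
        (𝓝 (∫ r in Ioo ε R, (m : ℝ) ^ 2 / r * u r ^ 2)) := by
    intro ε hε
    have hsub : Ioo ε R ⊆ Ioo 0 R := Ioo_subset_Ioo_left hε.1.le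
    refine tendsto_integral_of_dominated_convergence (fun _ => (m : ℝ) ^ 2 / ε ^ 2 * D ^ 2)
      (fun n => ((relaxed.integrableOn_centrifugal (hwr (φ n))).mono_set hsub).aestronglyMeasurable)
      (hconst _ _ hsub) (fun n => ?_) ?_
    · filter_upwards [ae_restrict_mem measurableSet_Ioo] with r hr
      have hr0 := (hsub hr).1
      have hε0 := hε.1
      rw [Real.norm_of_nonneg (by positivity)]
      calc (m : ℝ) ^ 2 / r * w (φ n) r ^ 2 = (m : ℝ) ^ 2 / r ^ 2 * (r * w (φ n) r ^ 2) := by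
            field_simp
        _ ≤ _ := by
            gcongr
            · exact hr.1.le
            · exact hbound _ r (hsub hr)
    · filter_upwards [ae_restrict_mem measurableSet_Ioo] with r hr
      exact ((hpt r (hsub hr)).pow 2).const_mul _
  -- lower semicontinuity away from the singular end point
  have hlower : ∀ ε ∈ Ioo 0 R, ‖f‖ ^ 2 + (∫ r in Ioo ε R, (m : ℝ) ^ 2 / r * u r ^ 2)
      + (∫ r in Ioo 0 R, r / α * Real.log (1 + α * u r ^ 2)) ≤ 2 * sInf S := by
    intro ε hε
    have hl := ((((hweak f).const_mul 2).sub_const (‖f‖ ^ 2)).add (hcen_lim ε hε)).add hlog_lim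
    have hr := (hs_lim.comp hφ.tendsto_atTop).const_mul 2
    have hle := le_of_tendsto_of_tendsto' hl hr fun n => ?_
    · rw [real_inner_self_eq_norm_sq] at hle
      linarith
    · have h1 : 2 * inner ℝ (F (φ n)) f - ‖f‖ ^ 2 ≤ ∫ r in Ioo 0 R, r * deriv (w (φ n)) r ^ 2 := by
        rw [← hFsq]
        have := norm_sub_sq_real (F (φ n)) f
        nlinarith [sq_nonneg ‖F (φ n) - f‖]
      have h2 : (∫ r in Ioo ε R, (m : ℝ) ^ 2 / r * w (φ n) r ^ 2)
          ≤ ∫ r in Ioo 0 R, (m : ℝ) ^ 2 / r * w (φ n) r ^ 2 := by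
        refine setIntegral_mono_set (relaxed.integrableOn_centrifugal (hwr (φ n))) ?_
          (Filter.Eventually.of_forall (Ioo_subset_Ioo_left hε.1.le))
        filter_upwards [ae_restrict_mem measurableSet_Ioo] with r hr
        have := hr.1
        simp only [Pi.zero_apply]; positivity
      have h3 := hsplit _ (hwr (φ n))
      rw [hws] at h3
      simp only [Function.comp_apply]
      linarith
  -- monotone exhaustion of `(0, R)`
  have huac : ∀ a ∈ Ioo 0 R, AbsolutelyContinuousOnInterval u a R := fun a ha =>
    absolutelyContinuousOnInterval_primitive hf ha
  have hcover : AECover μ atTop fun n : ℕ => Ioo (R / (n + 2)) R := by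
    refine aecover_Ioo_of_Ioo ?_ tendsto_const_nhds
    refine Tendsto.div_atTop tendsto_const_nhds ?_
    exact tendsto_atTop_add_const_right _ _ tendsto_natCast_atTop_atTop
  have hεn : ∀ n : ℕ, R / ((n : ℝ) + 2) ∈ Ioo 0 R := fun n => by
    have hn0 : (0 : ℝ) ≤ n := Nat.cast_nonneg n
    exact ⟨by positivity, div_lt_self hR (by linarith)⟩
  have hrestr : ∀ n : ℕ, μ.restrict (Ioo (R / ((n : ℝ) + 2)) R)
      = volume.restrict (Ioo (R / ((n : ℝ) + 2)) R) := fun n => by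
    rw [hμ, Measure.restrict_restrict measurableSet_Ioo,
      inter_eq_left.2 (Ioo_subset_Ioo_left (hεn n).1.le)]
  set I := 2 * sInf S - ‖f‖ ^ 2 - ∫ r in Ioo 0 R, r / α * Real.log (1 + α * u r ^ 2) with hI
  have hIn : ∀ n : ℕ, ∫ r in Ioo (R / ((n : ℝ) + 2)) R, (m : ℝ) ^ 2 / r * u r ^ 2 ∂μ ≤ I := fun n => by
    rw [hrestr n, hI]; linarith [hlower _ (hεn n)]
  have hcen : Integrable (fun r => (m : ℝ) ^ 2 / r * u r ^ 2) μ := by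
    refine hcover.integrable_of_integral_bounded_of_nonneg_ae I (fun n => ?_) ?_
      (Eventually.of_forall hIn)
    · rw [IntegrableOn, hrestr n]
      have h1 := (huac _ (hεn n)).continuousOn
      rw [uIcc_of_le (hεn n).2.le] at h1
      exact ((continuousOn_const.div continuousOn_id fun r hr =>
        ((hεn n).1.trans_le hr.1).ne').mul (h1.pow 2)).integrableOn_Icc.mono_set
          Ioo_subset_Icc_self
    · filter_upwards [ae_restrict_mem measurableSet_Ioo] with r hr
      have := hr.1
      positivity
  have hcenI : ∫ r in Ioo 0 R, (m : ℝ) ^ 2 / r * u r ^ 2 ≤ I :=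
    le_of_tendsto' (hcover.integral_tendsto_of_countably_generated hcen) hIn
  have hfsq : Integrable (fun r => f r ^ 2) μ := hf.integrable_sq
  have hkin_ae := ae_kinetic_primitive hf
  have hkin : Integrable (fun r => r * deriv u r ^ 2) μ :=
    hfsq.congr (hkin_ae.mono fun r hr => hr.symm)
  have hkinI : ∫ r in Ioo 0 R, r * deriv u r ^ 2 = ‖f‖ ^ 2 := by
    rw [integral_congr_ae hkin_ae, ← real_inner_self_eq_norm_sq, ← hf_toLp,
      inner_toLp_eq_integral, hf_toLp]
    simp only [sq, hμ]
  have hur : u ∈ relaxed m R := ⟨huac, by simp [hu, primitive], hkin.add hcen⟩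
  refine ⟨u, hur, by simp [hu, primitive], hflux, fun v hv hvP => ?_⟩
  have h1 : sInf S ≤ action m α R v := csInf_le hSbdd ⟨v, ⟨hv, hvP⟩, rfl⟩
  have h2 := hsplit u hur
  rw [hkinI] at h2
  linarith

end PhotorefractiveSoliton

theorem theorem2 (m : ℤ) (hm : m ≠ 0) (α R P₀ : ℝ) (hα : 1 ≤ α) (hR : 0 < R) (hP₀ : 0 < P₀) :
    (∃ (u : ℝ → ℝ) (β : ℝ),
      PhotorefractiveSoliton.IsMinimizer m α R P₀ u ∧
      PhotorefractiveSoliton.IsPositiveSolution m α R β u ∧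
      PhotorefractiveSoliton.IsLagrangeMultiplier m α R u (-β / (4 * Real.pi))) ∧
    (∀ u : ℝ → ℝ, PhotorefractiveSoliton.IsMinimizer m α R P₀ u →
      (∀ r ∈ Set.Icc 0 R, 0 ≤ u r) →
      ∃ β : ℝ,
        PhotorefractiveSoliton.IsPositiveSolution m α R β u ∧
        PhotorefractiveSoliton.IsLagrangeMultiplier m α R u (-β / (4 * Real.pi))) := by
  have hα0 : 0 < α := zero_lt_one.trans_le hα
  refine ⟨?_, fun u hu hnn => ⟨_, hu.isPositiveSolution hm hα0 hR hP₀ hnn⟩⟩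
  obtain ⟨u, hu, hu0, hP, hmin⟩ :=
    PhotorefractiveSoliton.exists_relaxed_minimizer hm hα0 hR hP₀
  obtain ⟨w, hw, hnn⟩ := PhotorefractiveSoliton.exists_nonneg_isMinimizer_of_relaxed hm hα0 hR hP₀
    hu hu0 hP hmin
  exact ⟨w, _, hw, hw.isPositiveSolution hm hα0 hR hP₀ fun r _ => hnn r⟩
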